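/- Take the triangular lattice with a system of coordinates whose $i$-axis runs along a horizontal lattice line with unit half the length of a lattice edge, whose $j$-axis is perpendicular to it at a lattice vertex (the origin), with unit the height of a unit triangle. Let $x,n\ge 0$ be integers and let $1\le s_1<s_2<\dots<s_n\le n+x$ be integers. Consider the right trapezoidal region with side-lengths $x,\,2n,\,x+n,\,2n$ (counter-clockwise from the north side), whose base runs along the $i$-axis from $(0,0)$ to $(2(x+n),0)$, whose west side is the vertical zigzag $(0,0),(-1,1),(0,2),(-1,3),\dots,(0,2n)$, and whose northeast side runs along a lattice line from $(2(x+n),0)$ to $(2x,2n)$. Remove from it the up-pointing unit triangles at the positions $s_1,\dots,s_n$ (counted from left to right) along the base. Weight each vertical lozenge with center $(i,j)$ by $\frac{q^{i}+q^{-i}}{2}$ if $i\ne 0$ and by $\frac12$ if $i=0$ (that is, if the $j$-axis passes through its center), and every other lozenge by $1$; the weight of a lozenge tiling is the product of the weights of its lozenges. Denote the resulting weighted region by $R^4_x(s_1,\dots,s_n)$ and by $\operatorname{M}(R^4_x(s_1,\dots,s_n))$ the sum of the weights of all its lozenge tilings (which is $1$ for the empty region, $n=0$). Write $[m]_q=1+q+\dots+q^{m-1}$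 and $[m]_q!=[1]_q[2]_q\cdots[m]_q$. Then, as rational functions of the indeterminate $q$ over $\mathbb{Q}$, \begin{align*} \operatorname{M}(R^{4}_{x}(s_1,\dots,s_n))&=2^{-n^2}q^{-\sum_{i=1}^n((4i-2)s_i-2i^2-i+1)}\, \frac{\prod_{i=1}^{n}[2s_i-1]_{q^2}\prod_{1\leq i < j\leq n}[2(s_i+s_j-1)]_{q^2}[2(s_j-s_i)]_{q^2}}{\prod_{i=1}^{n}[2i-1]_{q^2}!}\\ &=2^{-n^2}q^{-\sum_{i=1}^n((4i-2)s_i-2i^2-i+1)}\prod_{i=1}^{n}\frac{1}{q^{4s_i-2}+1}\prod_{1\leq i \leq j\leq n}\frac{[2(s_i+s_j-1)]_{q^2}}{[i+j-1]_{q^2}} \prod_{1\leq i < j\leq n}\frac{[2(s_j-s_i)]_{q^2}}{[j-i]_{q^2}}. \end{align*} -/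

import Mathlib

/-! Coordinates: on the triangular lattice take the horizontal unit to be half the edge of a lozenge
and the vertical unit to be the height of a unit triangle.  The lattice vertices are then the integer
points `(i, j)` with `i + j` even. -/

/-- A unit triangle `(a, r)` of the triangular lattice: it lies in the horizontal strip
`r ≤ j ≤ r + 1`, and its vertical symmetry axis is the line `i = a`. -/
abbrev UnitTriangle : Type := ℤ × ℤ

/-- The triangle points up: its vertices are `(a - 1, r)`, `(a + 1, r)` and `(a, r + 1)`. -/
def UnitTriangle.IsUp (t : UnitTriangle) : Prop := Odd (t.1 + t.2)

/-- The triangle points down: its vertices are `(a - 1, r + 1)`, `(a + 1, r + 1)` and `(a, r)`. -/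
def UnitTriangle.IsDown (t : UnitTriangle) : Prop := Even (t.1 + t.2)

open Classical in
/-- The three vertices of a unit triangle. -/
noncomputable def UnitTriangle.vertices (t : UnitTriangle) : Finset (ℤ × ℤ) :=
  if t.IsUp then {(t.1 - 1, t.2), (t.1 + 1, t.2), (t.1, t.2 + 1)}
  else {(t.1 - 1, t.2 + 1), (t.1 + 1, t.2 + 1), (t.1, t.2)}

/-- A pair of unit triangles `L = (d, u)` is a lozenge: `d` points down, `u` points up, and they share
an edge, so that `u` is the left or right neighbour of `d` in the same strip, or `u` sits on the
horizontal edge on top of `d`. -/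
def IsLozenge (L : UnitTriangle × UnitTriangle) : Prop :=
  L.1.IsDown ∧ L.2.IsUp ∧
    (L.2 = (L.1.1 - 1, L.1.2) ∨ L.2 = (L.1.1 + 1, L.1.2) ∨ L.2 = (L.1.1, L.1.2 + 1))

open Classical in
/-- The lozenge tilings of a finite region (a finite set of unit triangles): sets of lozenges inside
the region such that each unit triangle of the region belongs to exactly one of them. -/
noncomputable def lozengeTilings (R : Finset UnitTriangle) :
    Finset (Finset (UnitTriangle × UnitTriangle)) :=
  (R ×ˢ R).powerset.filter fun T =>
    (∀ L ∈ T, IsLozenge L) ∧ ∀ t ∈ R, ∃! L, L ∈ T ∧ (t = L.1 ∨ t = L.2)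

/-- The tiling generating function of a weighted region: the sum over all tilings of the product of
the weights of the lozenges. -/
noncomputable def tilingGF {K : Type*} [Field K] (R : Finset UnitTriangle)
    (wt : UnitTriangle × UnitTriangle → K) : K :=
  ∑ T ∈ lozengeTilings R, ∏ L ∈ T, wt L

/-- The weight `wt₂`.  A vertical lozenge (two triangles with the same symmetry axis) with center
`(i, j)` has weight `(q ^ i + q ^ (-i)) / 2`, except that it has weight `1 / 2` when it is cut by the
`j`-axis, i.e. `i = 0`.  The other lozenges have weight `1`. -/
noncomputable def wt₂ {K : Type*} [Field K] (q : K) (L : UnitTriangle × UnitTriangle) : K :=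
  if L.1.1 = L.2.1 then
    if L.1.1 = 0 then 1 / 2 else (q ^ L.1.1 + q ^ (-L.1.1)) / 2
  else 1

/-- The abscissa of the vertical zigzag on the west at integer height `j`: the zigzag starts at the
origin and runs through `(0, 0), (-1, 1), (0, 2), (-1, 3), …`. -/
def westEnd (j : ℤ) : ℤ := if Even j then 0 else -1

/-- The abscissa of the northeast side at height `j`: it runs along a lattice line from the right end
`(2 * (x + n), 0)` of the base. -/
def eastEnd (x n : ℕ) (j : ℤ) : ℤ := 2 * (x + n) - j

open Classical in
/-- The right trapezoidal region with side-lengths `x, 2 * n, x + n, 2 * n` (from the north side,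
counter-clockwise), with the base on the `i`-axis. A unit triangle lies in it iff its vertices do. -/
noncomputable def trapezoid (x n : ℕ) : Finset UnitTriangle :=
  (Finset.Icc (-1 : ℤ) (2 * (x + n)) ×ˢ Finset.Ico (0 : ℤ) (2 * n)).filter fun t =>
    ∀ v ∈ t.vertices, westEnd v.2 ≤ v.1 ∧ v.1 ≤ eastEnd x n v.2

/-- The `p`-th up-pointing unit triangle along the base, from left to right, `p = 1, 2, …`. -/
def baseTriangle (p : ℕ) : UnitTriangle := (2 * (p : ℤ) - 1, 0)

/-- The quartered hexagon: the trapezoid with dents at the positions `s 1, …, s n` of the base. -/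
noncomputable def quarteredHexagon (x n : ℕ) (s : ℕ → ℕ) : Finset UnitTriangle :=
  trapezoid x n \ (Finset.Icc 1 n).image fun i => baseTriangle (s i)

/-- The `q`-integer `[m]_q = 1 + q + ⋯ + q ^ (m - 1)`. -/
def qInt {K : Type*} [Field K] (q : K) (m : ℕ) : K := ∑ k ∈ Finset.range m, q ^ k

/-- The `q`-factorial `[m]_q! = [1]_q [2]_q ⋯ [m]_q`. -/
def qFactorial {K : Type*} [Field K] (q : K) (m : ℕ) : K := ∏ k ∈ Finset.Icc 1 m, qInt q k

/-! Cut the region into its `2 * n` horizontal strips. In a strip with prescribed dents, the tiling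
is forced once the vertical lozenges crossing its top line are chosen, and the admissible choices
are those interlacing with the dents. The upper halves of these lozenges are then dents of the part
above. So the generating function is a weighted sum over chains of interlacing sequences.

Suppose that the part above has generating function `C * det (γ (t i))` in the positions `t` of its
dents. Summation over all `t` interlacing with the dents of the strip below then gives, by
multilinearity, a determinant in the weighted partial sums `G` of `γ` (`tilingGF_openRow_eq_det`).
In a strip of even height all rows are measured from `G 0 = 0`. In a strip of odd height there is
one dent more than there are lozenges, and the rows are differences from the first dent, that is, a
determinant bordered by a column of ones.

Write `S = qSinh` and `C = qCosh`. The weights are such that two families of determinants reproduce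
each other: `S ((2j+1)(2σ i + 1))` on even lines and `C (4 j t i)` on odd ones. By the
product-to-sum formulas the partial sums of a column are combinations of two neighbouring columns of
the other family (`oddSum_succ`, `evenSum_succ`), and column operations remove the extra one
(`det_oddSum`, `det_evenSum`). The halved weight on the `j`-axis supplies the right initial value.
Each pair of strips thus contributes a constant, `stepFactor`.

The determinant left at the base is a Vandermonde determinant in `C (2 u i)` with `u i = 2 s i - 1`
(`det_qSinh`). The rest is bookkeeping of powers of `q` and `2`. -/

/-! ### Lozenge tilings and expansion along one triangle -/

open Classical in
theorem mem_lozengeTilings {R : Finset UnitTriangle} {T : Finset (UnitTriangle × UnitTriangle)} :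
    T ∈ lozengeTilings R ↔ (∀ L ∈ T, L.1 ∈ R ∧ L.2 ∈ R) ∧ (∀ L ∈ T, IsLozenge L) ∧
      ∀ t ∈ R, ∃! L, L ∈ T ∧ (t = L.1 ∨ t = L.2) := by
  simp only [lozengeTilings, Finset.mem_filter, Finset.mem_powerset, Finset.subset_iff,
    Finset.mem_product]

theorem eq_of_mem_lozengeTilings {R : Finset UnitTriangle}
    {T : Finset (UnitTriangle × UnitTriangle)} (hT : T ∈ lozengeTilings R)
    {L L' : UnitTriangle × UnitTriangle} (hL : L ∈ T) (hL' : L' ∈ T) {t : UnitTriangle}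
    (ht : t = L.1 ∨ t = L.2) (ht' : t = L'.1 ∨ t = L'.2) : L = L' := by
  obtain ⟨h1, -, h3⟩ := mem_lozengeTilings.1 hT
  have htR : t ∈ R := by
    rcases ht with rfl | rfl
    exacts [(h1 L hL).1, (h1 L hL).2]
  exact (h3 t htR).unique ⟨hL, ht⟩ ⟨hL', ht'⟩

theorem insert_mem_lozengeTilings {R : Finset UnitTriangle} {L : UnitTriangle × UnitTriangle}
    (hL : IsLozenge L) (h1 : L.1 ∈ R) (h2 : L.2 ∈ R) {T : Finset (UnitTriangle × UnitTriangle)}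
    (hT : T ∈ lozengeTilings (R \ {L.1, L.2})) : insert L T ∈ lozengeTilings R := by
  obtain ⟨hT1, hT2, hT3⟩ := mem_lozengeTilings.1 hT
  simp only [Finset.mem_sdiff, Finset.mem_insert, Finset.mem_singleton, not_or] at hT1 hT3
  refine mem_lozengeTilings.2 ⟨?_, ?_, ?_⟩
  · intro L' h
    rcases Finset.mem_insert.1 h with rfl | h
    · exact ⟨h1, h2⟩
    · exact ⟨(hT1 L' h).1.1, (hT1 L' h).2.1⟩
  · intro L' h
    rcases Finset.mem_insert.1 h with rfl | h
    exacts [hL, hT2 L' h]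
  · intro t ht
    by_cases htL : t = L.1 ∨ t = L.2
    · refine ⟨L, ⟨Finset.mem_insert_self _ _, htL⟩, ?_⟩
      rintro L' ⟨h, ht'⟩
      rcases Finset.mem_insert.1 h with rfl | h
      · rfl
      · exfalso
        obtain ⟨⟨-, h3, h4⟩, -, h5, h6⟩ := hT1 L' h
        rcases ht' with rfl | rfl <;> tauto
    · obtain ⟨L', ⟨h, ht'⟩, hu⟩ := hT3 t ⟨ht, by tauto⟩
      refine ⟨L', ⟨Finset.mem_insert_of_mem h, ht'⟩, ?_⟩
      rintro L'' ⟨h'', ht''⟩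
      rcases Finset.mem_insert.1 h'' with rfl | h''
      · exact absurd ht'' htL
      · exact hu L'' ⟨h'', ht''⟩

theorem notMem_of_mem_lozengeTilings_sdiff {R : Finset UnitTriangle}
    {L : UnitTriangle × UnitTriangle} {T : Finset (UnitTriangle × UnitTriangle)}
    (hT : T ∈ lozengeTilings (R \ {L.1, L.2})) : L ∉ T := by
  intro h
  have := ((mem_lozengeTilings.1 hT).1 L h).1
  simp at this

open Classical in
theorem erase_mem_lozengeTilings {R : Finset UnitTriangle} {L : UnitTriangle × UnitTriangle}
    {T : Finset (UnitTriangle × UnitTriangle)} (hT : T ∈ lozengeTilings R) (hL : L ∈ T) :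
    T.erase L ∈ lozengeTilings (R \ {L.1, L.2}) := by
  obtain ⟨hT1, hT2, hT3⟩ := mem_lozengeTilings.1 hT
  refine mem_lozengeTilings.2 ⟨?_, ?_, ?_⟩
  · intro L' h
    obtain ⟨hne, h⟩ := Finset.mem_erase.1 h
    simp only [Finset.mem_sdiff, Finset.mem_insert, Finset.mem_singleton]
    exact ⟨⟨(hT1 L' h).1, fun h' => hne (eq_of_mem_lozengeTilings hT h hL (Or.inl rfl) h')⟩,
      ⟨(hT1 L' h).2, fun h' => hne (eq_of_mem_lozengeTilings hT h hL (Or.inr rfl) h')⟩⟩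
  · exact fun L' h => hT2 L' (Finset.mem_of_mem_erase h)
  · intro t ht
    simp only [Finset.mem_sdiff, Finset.mem_insert, Finset.mem_singleton] at ht
    obtain ⟨L', ⟨h, ht'⟩, hu⟩ := hT3 t ht.1
    refine ⟨L', ⟨Finset.mem_erase.2 ⟨?_, h⟩, ht'⟩, ?_⟩
    · rintro rfl
      exact ht.2 ht'
    · rintro L'' ⟨h'', ht''⟩
      exact hu L'' ⟨Finset.mem_of_mem_erase h'', ht''⟩

open Classical in
/-- Expansion of the tiling generating function along the lozenge that covers a given triangle. -/
theorem tilingGF_expand {K : Type*} [Field K] {R : Finset UnitTriangle} {t : UnitTriangle}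
    (ht : t ∈ R) (wt : UnitTriangle × UnitTriangle → K) :
    tilingGF R wt =
      ∑ L ∈ (R ×ˢ R).filter (fun L => IsLozenge L ∧ (t = L.1 ∨ t = L.2)),
        wt L * tilingGF (R \ {L.1, L.2}) wt := by
  simp only [tilingGF, Finset.mul_sum]
  rw [Finset.sum_sigma']
  symm
  refine Finset.sum_bij (fun p _ => insert p.1 p.2) ?_ ?_ ?_ ?_
  · rintro ⟨L, T⟩ hp
    simp only [Finset.mem_sigma, Finset.mem_filter, Finset.mem_product] at hp
    exact insert_mem_lozengeTilings hp.1.2.1 hp.1.1.1 hp.1.1.2 hp.2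
  · rintro ⟨L, T⟩ hp ⟨L', T'⟩ hp' h
    simp only [Finset.mem_sigma, Finset.mem_filter, Finset.mem_product] at hp hp' h
    have hm := insert_mem_lozengeTilings hp.1.2.1 hp.1.1.1 hp.1.1.2 hp.2
    have hLL : L = L' := eq_of_mem_lozengeTilings hm (Finset.mem_insert_self _ _)
      (h ▸ Finset.mem_insert_self _ _) hp.1.2.2 hp'.1.2.2
    subst hLL
    have := congrArg (fun s => Finset.erase s L) h
    simp only [Finset.erase_insert (notMem_of_mem_lozengeTilings_sdiff hp.2),
      Finset.erase_insert (notMem_of_mem_lozengeTilings_sdiff hp'.2)] at this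
    rw [this]
  · intro T hT
    obtain ⟨hT1, hT2, hT3⟩ := mem_lozengeTilings.1 hT
    obtain ⟨L, ⟨hL, htL⟩, -⟩ := hT3 t ht
    refine ⟨⟨L, T.erase L⟩, ?_, Finset.insert_erase hL⟩
    simp only [Finset.mem_sigma, Finset.mem_filter, Finset.mem_product]
    exact ⟨⟨hT1 L hL, hT2 L hL, htL⟩, erase_mem_lozengeTilings hT hL⟩
  · rintro ⟨L, T⟩ hp
    simp only [Finset.mem_sigma] at hp
    rw [Finset.prod_insert (notMem_of_mem_lozengeTilings_sdiff hp.2)]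

theorem tilingGF_empty {K : Type*} [Field K] (wt : UnitTriangle × UnitTriangle → K) :
    tilingGF ∅ wt = 1 := by
  have : lozengeTilings ∅ = {∅} := by
    ext T
    rw [mem_lozengeTilings, Finset.mem_singleton]
    constructor
    · rintro ⟨h, -⟩
      exact Finset.eq_empty_of_forall_notMem fun L hL => by simpa using h L hL
    · rintro rfl
      simp
  simp [tilingGF, this]

open Classical in
theorem tilingGF_of_isDown {K : Type*} [Field K] {R : Finset UnitTriangle} {a r : ℤ}
    (h : Even (a + r)) (hR : (a, r) ∈ R) (hl : (a - 1, r) ∉ R)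
    (wt : UnitTriangle × UnitTriangle → K) :
    tilingGF R wt =
      (if (a + 1, r) ∈ R then
        wt ((a, r), (a + 1, r)) * tilingGF (R \ {(a, r), (a + 1, r)}) wt else 0) +
      (if (a, r + 1) ∈ R then
        wt ((a, r), (a, r + 1)) * tilingGF (R \ {(a, r), (a, r + 1)}) wt else 0) := by
  rw [tilingGF_expand hR]
  have hd : ∀ L, IsLozenge L → ((a, r) = L.1 ∨ (a, r) = L.2) → L.1 = (a, r) := by
    intro L hL h'
    rcases h' with h' | h'
    · exact h'.symm
    · have := hL.2.1
      rw [← h'] at this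
      exact absurd h (Int.not_even_iff_odd.2 this)
  have key : (R ×ˢ R).filter (fun L => IsLozenge L ∧ ((a, r) = L.1 ∨ (a, r) = L.2)) =
      (if (a + 1, r) ∈ R then {((a, r), (a + 1, r))} else ∅) ∪
      (if (a, r + 1) ∈ R then {((a, r), (a, r + 1))} else ∅) := by
    ext L
    simp only [Finset.mem_filter, Finset.mem_product, Finset.mem_union]
    constructor
    · rintro ⟨⟨h1, h2⟩, hL, h'⟩
      have e1 := hd L hL h'
      obtain ⟨L1, L2⟩ := L
      simp only at e1 h1 h2
      subst e1
      rcases hL.2.2 with e | e | e <;> simp only at e <;> subst e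
      · exact absurd h2 hl
      · left
        rw [if_pos h2]
        exact Finset.mem_singleton_self _
      · right
        rw [if_pos h2]
        exact Finset.mem_singleton_self _
    · rintro (h' | h') <;> split_ifs at h' with h2
      · obtain rfl := Finset.mem_singleton.1 h'
        refine ⟨⟨hR, h2⟩, ⟨h, ?_, Or.inr (Or.inl rfl)⟩, Or.inl rfl⟩
        change Odd (a + 1 + r)
        have := h.add_one
        rwa [add_right_comm]
      · exact absurd h' (Finset.notMem_empty _)
      · obtain rfl := Finset.mem_singleton.1 h'
        refine ⟨⟨hR, h2⟩, ⟨h, ?_, Or.inr (Or.inr rfl)⟩, Or.inl rfl⟩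
        change Odd (a + (r + 1))
        have := h.add_one
        rwa [← add_assoc]
      · exact absurd h' (Finset.notMem_empty _)
  rw [key, Finset.sum_union]
  · congr 1 <;> split_ifs <;> simp
  · split_ifs <;> simp

open Classical in
theorem tilingGF_of_isUp {K : Type*} [Field K] {R : Finset UnitTriangle} {a r : ℤ}
    (h : Odd (a + r)) (hR : (a, r) ∈ R) (hl : (a - 1, r) ∉ R) (hb : (a, r - 1) ∉ R)
    (wt : UnitTriangle × UnitTriangle → K) :
    tilingGF R wt =
      if (a + 1, r) ∈ R then
        wt ((a + 1, r), (a, r)) * tilingGF (R \ {(a + 1, r), (a, r)}) wt else 0 := by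
  rw [tilingGF_expand hR]
  have hd : ∀ L, IsLozenge L → ((a, r) = L.1 ∨ (a, r) = L.2) → L.2 = (a, r) := by
    intro L hL h'
    rcases h' with h' | h'
    · have := hL.1
      rw [← h'] at this
      exact absurd this (Int.not_even_iff_odd.2 h)
    · exact h'.symm
  have key : (R ×ˢ R).filter (fun L => IsLozenge L ∧ ((a, r) = L.1 ∨ (a, r) = L.2)) =
      (if (a + 1, r) ∈ R then {((a + 1, r), (a, r))} else ∅) := by
    ext L
    simp only [Finset.mem_filter, Finset.mem_product]
    constructor
    · rintro ⟨⟨h1, h2⟩, hL, h'⟩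
      have e1 := hd L hL h'
      obtain ⟨⟨L1, L1'⟩, L2⟩ := L
      simp only at e1 h1 h2
      subst e1
      rcases hL.2.2 with e | e | e <;> simp only [Prod.mk.injEq] at e
      · obtain ⟨e, e'⟩ := e
        obtain rfl : L1 = a + 1 := by omega
        subst e'
        rw [if_pos h1]
        exact Finset.mem_singleton_self _
      · obtain ⟨e, e'⟩ := e
        obtain rfl : L1 = a - 1 := by omega
        subst e'
        exact absurd h1 hl
      · obtain ⟨e, e'⟩ := e
        obtain rfl : L1' = r - 1 := by omega
        subst e
        exact absurd h1 hb
    · intro h'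
      split_ifs at h' with h2
      · obtain rfl := Finset.mem_singleton.1 h'
        refine ⟨⟨h2, hR⟩, ⟨?_, h, Or.inl ?_⟩, Or.inr rfl⟩
        · change Even (a + 1 + r)
          have := h.add_one
          rwa [add_right_comm]
        · simp
      · exact absurd h' (Finset.notMem_empty _)
  rw [key]
  split_ifs <;> simp

/-! ### Sweeping one strip from left to right -/

open Classical in
/-- The part `D_c, U_c, D_{c+1}, U_{c+1}, …, U_{N-1}` of the strip at height `r`, where `D_j` is the
down-pointing triangle at `2 * j + e` and `U_j` the up-pointing one at its right, with the triangles
`U_j`, `j ∈ S`, removed. -/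
noncomputable def openRow (e r : ℤ) (N c : ℕ) (S : Finset ℕ) : Finset UnitTriangle :=
  (Finset.Ico c N).image (fun j : ℕ => (2 * (j : ℤ) + e, r)) ∪
    (Finset.Ico c N \ S).image (fun j : ℕ => (2 * (j : ℤ) + e + 1, r))

open Classical in
/-- The strip `openRow e r N c S` without its leftmost down-pointing triangle. -/
noncomputable def closedRow (e r : ℤ) (N c : ℕ) (S : Finset ℕ) : Finset UnitTriangle :=
  (Finset.Ico (c + 1) N).image (fun j : ℕ => (2 * (j : ℤ) + e, r)) ∪
    (Finset.Ico c N \ S).image (fun j : ℕ => (2 * (j : ℤ) + e + 1, r))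

section rows

variable {e r : ℤ} {N c : ℕ} {S : Finset ℕ}

theorem mem_openRow {t : UnitTriangle} : t ∈ openRow e r N c S ↔
    ∃ j : ℕ, c ≤ j ∧ j < N ∧ (t = (2 * (j : ℤ) + e, r) ∨ (j ∉ S ∧ t = (2 * (j : ℤ) + e + 1, r))) := by
  simp only [openRow, Finset.mem_union, Finset.mem_image, Finset.mem_Ico, Finset.mem_sdiff]
  constructor
  · rintro (⟨j, h, rfl⟩ | ⟨j, h, rfl⟩)
    exacts [⟨j, h.1, h.2, Or.inl rfl⟩, ⟨j, h.1.1, h.1.2, Or.inr ⟨h.2, rfl⟩⟩]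
  · rintro ⟨j, h1, h2, rfl | ⟨h3, rfl⟩⟩
    exacts [Or.inl ⟨j, ⟨h1, h2⟩, rfl⟩, Or.inr ⟨j, ⟨⟨h1, h2⟩, h3⟩, rfl⟩]

theorem bounds_of_mem_openRow {t : UnitTriangle} (h : t ∈ openRow e r N c S) :
    t.2 = r ∧ 2 * (c : ℤ) + e ≤ t.1 ∧ t.1 < 2 * (N : ℤ) + e := by
  obtain ⟨j, h1, h2, rfl | ⟨-, rfl⟩⟩ := mem_openRow.1 h <;> refine ⟨rfl, ?_, ?_⟩ <;> simp <;> omega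

open Classical in
theorem openRow_eq_insert (hc : c < N) :
    openRow e r N c S = insert (2 * (c : ℤ) + e, r) (closedRow e r N c S) := by
  rw [openRow, closedRow, ← Finset.insert_Ico_add_one_left_eq_Ico hc, Finset.image_insert,
    Finset.insert_union]

open Classical in
theorem closedRow_eq_insert (hc : c < N) (hS : c ∉ S) :
    closedRow e r N c S = insert (2 * (c : ℤ) + e + 1, r) (openRow e r N (c + 1) S) := by
  rw [openRow, closedRow, ← Finset.insert_Ico_add_one_left_eq_Ico hc,
    Finset.insert_sdiff_of_notMem _ hS, Finset.image_insert, Finset.union_insert]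

theorem closedRow_of_mem (hc : c < N) (hS : c ∈ S) :
    closedRow e r N c S = openRow e r N (c + 1) S := by
  rw [openRow, closedRow, ← Finset.insert_Ico_add_one_left_eq_Ico hc,
    Finset.insert_sdiff_of_mem _ hS]

theorem openRow_of_le (hc : N ≤ c) : openRow e r N c S = ∅ := by
  simp [openRow, Finset.Ico_eq_empty_of_le hc]

theorem bounds_of_mem_closedRow {t : UnitTriangle} (hc : c < N) (h : t ∈ closedRow e r N c S) :
    t.2 = r ∧ 2 * (c : ℤ) + e + 1 ≤ t.1 := by
  by_cases hS : c ∈ S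
  · rw [closedRow_of_mem hc hS] at h
    have := bounds_of_mem_openRow h
    push_cast at this
    exact ⟨this.1, by omega⟩
  · rw [closedRow_eq_insert hc hS] at h
    rcases Finset.mem_insert.1 h with rfl | h
    · exact ⟨rfl, le_rfl⟩
    · have := bounds_of_mem_openRow h
      push_cast at this
      exact ⟨this.1, by omega⟩

theorem insert_insert_sdiff_pair {α : Type*} [DecidableEq α] {a b : α} {B : Finset α} (ha : a ∉ B) (hb : b ∉ B) :
    insert a (insert b B) \ {a, b} = B := by
  ext x
  simp only [Finset.mem_sdiff, Finset.mem_insert, Finset.mem_singleton]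
  constructor
  · tauto
  · intro h
    refine ⟨Or.inr (Or.inr h), ?_⟩
    rintro (rfl | rfl) <;> contradiction

theorem insert_union_sdiff_pair {α : Type*} [DecidableEq α] {a b : α} {B A : Finset α} (ha : a ∉ B) (haA : a ∉ A)
    (hb : b ∉ B) : (insert a B ∪ A) \ {a, b} = B ∪ (A \ {b}) := by
  ext x
  simp only [Finset.mem_sdiff, Finset.mem_insert, Finset.mem_singleton, Finset.mem_union]
  constructor
  · tauto
  · rintro (h | h)
    · refine ⟨Or.inl (Or.inr h), ?_⟩
      rintro (rfl | rfl) <;> contradiction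
    · refine ⟨Or.inr h.1, ?_⟩
      rintro (rfl | rfl)
      exacts [haA h.1, h.2 rfl]

variable {K : Type*} [Field K] {wt : UnitTriangle × UnitTriangle → K} {A : Finset UnitTriangle}

open Classical in
-- The leftmost triangle `D_c` has no left neighbour, so it pairs with `U_c`, if that is present, or
-- with the triangle above it. In the second case `U_c`, if present, is left without its left
-- partner.
theorem tilingGF_openRow (her : Even (e + r)) (hwt : ∀ L, L.1.1 ≠ L.2.1 → wt L = 1)
    (hA : ∀ t ∈ A, r < t.2) (hc : c < N) :
    tilingGF (openRow e r N c S ∪ A) wt =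
      (if c ∈ S then 0 else tilingGF (openRow e r N (c + 1) S ∪ A) wt) +
        if (2 * (c : ℤ) + e, r + 1) ∈ A then
          wt ((2 * (c : ℤ) + e, r), (2 * (c : ℤ) + e, r + 1)) *
            tilingGF (closedRow e r N c S ∪ (A \ {(2 * (c : ℤ) + e, r + 1)})) wt
        else 0 := by
  have hAr : ∀ a : ℤ, (a, r) ∉ A := fun a h => lt_irrefl _ (hA _ h)
  have hcl : (2 * (c : ℤ) + e, r) ∉ closedRow e r N c S := fun h => by
    have := (bounds_of_mem_closedRow hc h).2
    simp only at this
    omega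
  have hcl' : (2 * (c : ℤ) + e, r + 1) ∉ closedRow e r N c S := fun h => by
    have := (bounds_of_mem_closedRow hc h).1
    simp only at this
    omega
  have hmem : (2 * (c : ℤ) + e + 1, r) ∈ openRow e r N c S ∪ A ↔ c ∉ S := by
    rw [Finset.mem_union, or_iff_left (hAr _), openRow_eq_insert hc, Finset.mem_insert]
    rw [or_iff_right (by simp)]
    by_cases hS : c ∈ S
    · rw [closedRow_of_mem hc hS]
      refine ⟨fun h => ?_, fun h => absurd hS h⟩
      have := (bounds_of_mem_openRow h).2.1
      push_cast at this
      omega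
    · rw [closedRow_eq_insert hc hS]
      simp [hS]
  have hmem' : (2 * (c : ℤ) + e, r + 1) ∈ openRow e r N c S ∪ A ↔
      (2 * (c : ℤ) + e, r + 1) ∈ A := by
    rw [Finset.mem_union, or_iff_right]
    intro h
    have := (bounds_of_mem_openRow h).1
    simp only at this
    omega
  rw [tilingGF_of_isDown (a := 2 * (c : ℤ) + e) (r := r)]
  · rw [if_congr hmem' rfl rfl]
    congr 1
    · by_cases hS : c ∈ S
      · rw [if_neg (by simpa [hmem] using hS), if_pos hS]
      · rw [if_pos (hmem.2 hS), if_neg hS, hwt _ (by simp), one_mul, openRow_eq_insert hc,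
          closedRow_eq_insert hc hS, Finset.insert_union, Finset.insert_union,
          insert_insert_sdiff_pair]
        · rw [Finset.mem_union, or_iff_left (hAr _)]
          intro h
          have := (bounds_of_mem_openRow h).2.1
          push_cast at this
          omega
        · rw [Finset.mem_union, or_iff_left (hAr _)]
          intro h
          have := (bounds_of_mem_openRow h).2.1
          push_cast at this
          omega
    · rw [openRow_eq_insert hc, insert_union_sdiff_pair hcl (hAr _) hcl']
  · rw [add_assoc]
    exact (even_two_mul _).add her
  · rw [openRow_eq_insert hc]
    simp
  · rw [Finset.mem_union, or_iff_left (hAr _)]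
    intro h
    have := (bounds_of_mem_openRow h).2.1
    simp only at this
    omega

/-- The leftmost triangle `U_c` has neither a left nor a lower neighbour, so its lozenge with
`D_{c+1}` is forced. -/
theorem tilingGF_closedRow_step (her : Even (e + r)) (hwt : ∀ L, L.1.1 ≠ L.2.1 → wt L = 1)
    (hA : ∀ t ∈ A, r < t.2) (hc : c < N) (hS : c ∉ S) :
    tilingGF (closedRow e r N c S ∪ A) wt =
      if c + 1 < N then tilingGF (closedRow e r N (c + 1) S ∪ A) wt else 0 := by
  classical
  have hAr : ∀ a : ℤ, (a, r) ∉ A := fun a h => lt_irrefl _ (hA _ h)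
  have hlow : ∀ a : ℤ, a < 2 * (c : ℤ) + e + 1 → (a, r) ∉ closedRow e r N c S ∪ A := by
    intro a ha
    rw [Finset.mem_union, or_iff_left (hAr _)]
    intro h
    have := (bounds_of_mem_closedRow hc h).2
    simp only at this
    omega
  rw [tilingGF_of_isUp (a := 2 * (c : ℤ) + e + 1) (r := r)]
  · split_ifs with h1 h2 h2
    · rw [hwt _ (by simp), one_mul, closedRow_eq_insert hc hS, openRow_eq_insert h2,
        Finset.insert_comm, Finset.insert_union, Finset.insert_union]
      have : (2 * ((c + 1 : ℕ) : ℤ) + e) = 2 * (c : ℤ) + e + 1 + 1 := by push_cast; ring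
      rw [this, insert_insert_sdiff_pair]
      · rw [Finset.mem_union, or_iff_left (hAr _)]
        intro h
        have := (bounds_of_mem_closedRow h2 h).2
        push_cast at this
        omega
      · rw [Finset.mem_union, or_iff_left (hAr _)]
        intro h
        have := (bounds_of_mem_closedRow h2 h).2
        push_cast at this
        omega
    · exfalso
      rw [Finset.mem_union, or_iff_left (hAr _), closedRow_eq_insert hc hS,
        openRow_of_le (by omega)] at h1
      simp at h1
    · exfalso
      apply h1
      rw [closedRow_eq_insert hc hS, openRow_eq_insert h2]
      have : (2 * ((c + 1 : ℕ) : ℤ) + e) = 2 * (c : ℤ) + e + 1 + 1 := by push_cast; ring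
      rw [this]
      simp
    · rfl
  · have : 2 * (c : ℤ) + e + 1 + r = 2 * c + (e + r) + 1 := by ring
    rw [this]
    exact ((even_two_mul _).add her).add_one
  · rw [closedRow_eq_insert hc hS]
    simp
  · exact hlow _ (by omega)
  · rw [Finset.mem_union, not_or]
    refine ⟨fun h => ?_, fun h => ?_⟩
    · have := (bounds_of_mem_closedRow hc h).1
      simp only at this
      omega
    · have := hA _ h
      simp only at this
      omega

/-- The forced lozenges run to the east end, where the last up-pointing triangle finds no partner.
-/
theorem tilingGF_closedRow_eq_zero (her : Even (e + r))
    (hwt : ∀ L, L.1.1 ≠ L.2.1 → wt L = 1) (hA : ∀ t ∈ A, r < t.2) (hc : c < N)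
    (hS : ∀ j, c ≤ j → j < N → j ∉ S) : tilingGF (closedRow e r N c S ∪ A) wt = 0 := by
  obtain ⟨d, hd⟩ : ∃ d, N - c = d := ⟨_, rfl⟩
  induction d generalizing c with
  | zero => omega
  | succ d ih =>
    rw [tilingGF_closedRow_step her hwt hA hc (hS c le_rfl hc)]
    split_ifs with h
    · exact ih h (fun j hj => hS j (by omega)) (by omega)
    · rfl

/-- The forced lozenges stop at the first dent `p`. Hence between two consecutive dents there is at
most one vertical lozenge: this is the interlacing. -/
theorem tilingGF_closedRow {p : ℕ} (her : Even (e + r))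
    (hwt : ∀ L, L.1.1 ≠ L.2.1 → wt L = 1) (hA : ∀ t ∈ A, r < t.2) (hc : c ≤ p) (hp : p < N)
    (hpS : p ∈ S) (hS : ∀ j, c ≤ j → j < p → j ∉ S) :
    tilingGF (closedRow e r N c S ∪ A) wt = tilingGF (openRow e r N (p + 1) S ∪ A) wt := by
  obtain ⟨d, hd⟩ : ∃ d, p - c = d := ⟨_, rfl⟩
  induction d generalizing c with
  | zero =>
    obtain rfl : c = p := by omega
    rw [closedRow_of_mem hp hpS]
  | succ d ih =>
    rw [tilingGF_closedRow_step her hwt hA (by omega) (hS c le_rfl (by omega)), if_pos (by omega)]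
    exact ih (by omega) (fun j hj => hS j (by omega)) (by omega)

/-! ### From a strip to a determinant -/

/-- Determinantal counterpart of one step of the sweep at `c`. Rows before `k` belong to vertical
lozenges already placed; the later ones are pending sums that start at `c`. Row `k` splits according
to whether its lozenge is placed at `c` or further right. -/
theorem det_pending_split {n : ℕ} (k : Fin n) (t σ : Fin n → ℕ) (γ G : ℕ → Fin n → K) (c : ℕ)
    (w : K) (hG : G (c + 1) = G c + w • γ c) :
    (Matrix.of fun i : Fin n => if i < k then γ (t i) else G (σ i + 1) - G c).det =
      (if σ k = c then 0
        else (Matrix.of fun i : Fin n => if i < k then γ (t i) else G (σ i + 1) - G (c + 1)).det) +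
      w * (Matrix.of fun i : Fin n => if (i : ℕ) < k + 1 then γ (Function.update t k c i)
        else G (σ i + 1) - G (σ k + 1)).det := by
  set M : Matrix (Fin n) (Fin n) K := Matrix.of fun i : Fin n =>
    if i < k then γ (t i) else G (σ i + 1) - G (σ k + 1) with hM
  have h1 : ∀ d, (Matrix.of fun i : Fin n => if i < k then γ (t i) else G (σ i + 1) - G d).det =
      (M.updateRow k (G (σ k + 1) - G d)).det := by
    intro d
    -- Subtracting row `k` from the later rows moves their starting point from `d` to `σ k + 1`, so
    -- that only row `k` depends on `d`.
    refine Matrix.det_eq_of_forall_row_eq_smul_add_const (fun i => if k < i then 1 else 0) k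
      (by simp) ?_
    intro i j
    rcases lt_trichotomy i k with h | h | h
    · simp [Matrix.updateRow_apply, h.ne, h, h.not_gt, hM]
    · simp [h]
    · simp [Matrix.updateRow_apply, h.ne', h, h.not_gt, hM]
  have h2 : (Matrix.of fun i : Fin n => if (i : ℕ) < k + 1 then γ (Function.update t k c i)
        else G (σ i + 1) - G (σ k + 1)) = M.updateRow k (γ c) := by
    ext i j
    rcases lt_trichotomy i k with h | h | h
    · simp [Matrix.updateRow_apply, h.ne, h, h.le, hM]
    · subst h
      simp
    · simp [Matrix.updateRow_apply, h.ne', h.not_gt, h.not_ge, hM]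
  have h3 : G (σ k + 1) - G c = (G (σ k + 1) - G (c + 1)) + w • γ c := by
    rw [hG]
    abel
  rw [h2, h1, h1, h3, Matrix.det_updateRow_add, Matrix.det_updateRow_smul]
  congr 1
  -- If the dent `σ k` is at `c`, the lozenge cannot be postponed, and the pending row is the empty
  -- sum.
  split_ifs with h
  · rw [h, sub_self]
    exact Matrix.det_eq_zero_of_row_eq_zero k (by simp)
  · rfl

open Classical in
/-- Summation over the vertical lozenges on top of a strip with dents `σ`: if the rest of the region
has a determinantal generating function with rows `γ`, then the whole region has one with rows
the partial sums `G` of `w • γ`. -/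
theorem tilingGF_openRow_eq_det (her : Even (e + r)) (hwt : ∀ L, L.1.1 ≠ L.2.1 → wt L = 1)
    {n lo : ℕ} {σ : Fin n → ℕ} (hσ : StrictMono σ) (hσN : ∀ l, σ l < N)
    (hS : ∀ j, lo ≤ j → j < N → (j ∈ S ↔ ∃ l, σ l = j))
    (hA : ∀ t ∈ A, r < t.2)
    (hT : ∀ c : ℕ, lo ≤ c → c < N → 0 < n → (2 * (c : ℤ) + e, r + 1) ∈ A)
    {γ G : ℕ → Fin n → K} {C : K}
    (hG : ∀ c : ℕ, lo ≤ c → c < N →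
      G (c + 1) = G c + wt ((2 * (c : ℤ) + e, r), (2 * (c : ℤ) + e, r + 1)) • γ c)
    (H : ∀ t : Fin n → ℕ, StrictMono t → (∀ i, lo ≤ t i ∧ t i < N) →
      tilingGF (A \ Finset.univ.image fun i => (2 * (t i : ℤ) + e, r + 1)) wt =
        C * (Matrix.of fun i => γ (t i)).det)
    (k : ℕ) (t : Fin n → ℕ) (hlo : lo ≤ c) (hc : c ≤ N)
    (hk : ∀ l : Fin n, k ≤ (l : ℕ) ↔ c ≤ σ l)
    (ht : ∀ i j : Fin n, i < j → (j : ℕ) < k → t i < t j)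
    (htc : ∀ i : Fin n, (i : ℕ) < k → lo ≤ t i ∧ t i < c) :
    tilingGF (openRow e r N c S ∪ (A \ (Finset.univ.filter fun i : Fin n => (i : ℕ) < k).image
        fun i => (2 * (t i : ℤ) + e, r + 1))) wt =
      C * (Matrix.of fun i : Fin n =>
        if (i : ℕ) < k then γ (t i) else G (σ i + 1) - G c).det := by
  obtain ⟨d, hd⟩ : ∃ d, N - c = d := ⟨_, rfl⟩
  -- Strong induction, since placing a vertical lozenge makes the sweep jump past the next dent.
  induction d using Nat.strong_induction_on generalizing c k t with
  | _ d ih =>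
  rcases hc.eq_or_lt with rfl | hcN
  · have hkn : ∀ i : Fin n, (i : ℕ) < k := fun i => by
      by_contra h
      exact absurd ((hk i).1 (not_lt.1 h)) (not_le.2 (hσN i))
    rw [openRow_of_le le_rfl, Finset.empty_union]
    simp only [hkn, if_true, Finset.filter_true]
    exact H t (fun i j hij => ht i j hij (hkn j)) fun i => htc i (hkn i)
  · set B := A \ (Finset.univ.filter fun i : Fin n => (i : ℕ) < k).image
        fun i => (2 * (t i : ℤ) + e, r + 1) with hB
    have hBr : ∀ t ∈ B, r < t.2 := fun t h => hA t (Finset.mem_sdiff.1 h).1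
    have hBr' : ∀ t ∈ B \ {(2 * (c : ℤ) + e, r + 1)}, r < t.2 :=
      fun t h => hBr t (Finset.mem_sdiff.1 h).1
    rw [tilingGF_openRow her hwt hBr hcN]
    by_cases hkn : k < n
    · have hTB : (2 * (c : ℤ) + e, r + 1) ∈ B := by
        refine Finset.mem_sdiff.2 ⟨hT c hlo hcN (by omega), fun h => ?_⟩
        obtain ⟨i, hi, h⟩ := Finset.mem_image.1 h
        have := (htc i (Finset.mem_filter.1 hi).2).2
        simp only [Prod.mk.injEq] at h
        omega
      have hp : c ≤ σ ⟨k, hkn⟩ := (hk ⟨k, hkn⟩).1 le_rfl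
      have hpS : σ ⟨k, hkn⟩ ∈ S := (hS _ (hlo.trans hp) (hσN _)).2 ⟨_, rfl⟩
      have hnS : ∀ j, c ≤ j → j < σ ⟨k, hkn⟩ → j ∉ S := by
        intro j hj hj' hjS
        obtain ⟨l, rfl⟩ := (hS j (hlo.trans hj) (hj'.trans (hσN _))).1 hjS
        have h1 : k ≤ (l : ℕ) := (hk l).2 hj
        exact absurd (hσ.lt_iff_lt.1 hj') (not_lt.2 h1)
      have hcS : c ∈ S ↔ σ ⟨k, hkn⟩ = c := by
        constructor
        · intro h
          by_contra hne
          exact hnS c le_rfl (lt_of_le_of_ne hp (Ne.symm hne)) h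
        · intro h
          rw [← h]
          exact hpS
      have hupd : B \ {(2 * (c : ℤ) + e, r + 1)} =
          A \ (Finset.univ.filter fun i : Fin n => (i : ℕ) < k + 1).image
            fun i => (2 * (Function.update t ⟨k, hkn⟩ c i : ℤ) + e, r + 1) := by
        rw [hB, sdiff_sdiff_left]
        congr 1
        ext u
        simp only [Finset.sup_eq_union, Finset.mem_union, Finset.mem_image, Finset.mem_filter,
          Finset.mem_univ, true_and, Finset.mem_singleton]
        constructor
        · rintro (⟨i, hi, rfl⟩ | rfl)
          · refine ⟨i, by omega, ?_⟩
            rw [Function.update_of_ne]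
            rintro rfl
            simp at hi
          · exact ⟨⟨k, hkn⟩, by simp, by simp⟩
        · rintro ⟨i, hi, rfl⟩
          by_cases h : i = ⟨k, hkn⟩
          · right
            rw [h, Function.update_self]
          · left
            refine ⟨i, ?_, by rw [Function.update_of_ne h]⟩
            have : (i : ℕ) ≠ k := fun h' => h (Fin.ext h')
            omega
      have hdet := det_pending_split ⟨k, hkn⟩ t σ γ G c _ (hG c hlo hcN)
      simp only [Fin.lt_def] at hdet
      rw [hdet, mul_add, if_pos hTB]
      congr 1
      · by_cases h : c ∈ S
        · rw [if_pos h, if_pos (hcS.1 h), mul_zero]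
        · rw [if_neg h, if_neg (mt hcS.2 h)]
          refine ih (N - (c + 1)) (by omega) k t (by omega) hcN ?_ ht ?_ rfl
          · intro l
            rw [hk l]
            refine ⟨fun h' => ?_, fun h' => by omega⟩
            rcases h'.eq_or_lt with h'' | h''
            · exact absurd ((hS c hlo hcN).2 ⟨l, h''.symm⟩) h
            · exact h''
          · intro i hi
            have := htc i hi
            omega
      · rw [tilingGF_closedRow her hwt hBr' hp (hσN _) hpS hnS, hupd, mul_left_comm]
        congr 1
        refine ih (N - (σ ⟨k, hkn⟩ + 1)) (by have := hσN ⟨k, hkn⟩; omega) (k + 1)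
          (Function.update t ⟨k, hkn⟩ c) (by omega) (hσN _) ?_ ?_ ?_ rfl
        · intro l
          have : (⟨k, hkn⟩ : Fin n) < l ↔ σ ⟨k, hkn⟩ < σ l := hσ.lt_iff_lt.symm
          exact this
        · intro i j hij hj
          have hij' : (i : ℕ) < j := hij
          have hi : i ≠ ⟨k, hkn⟩ := by
            rintro rfl
            simp only at hij'
            omega
          rw [Function.update_of_ne hi]
          by_cases h : j = ⟨k, hkn⟩
          · rw [h, Function.update_self]
            refine (htc i ?_).2
            rw [h] at hij'
            exact hij'
          · rw [Function.update_of_ne h]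
            refine ht i j hij ?_
            have : (j : ℕ) ≠ k := fun h' => h (Fin.ext h')
            omega
        · intro i hi
          by_cases h : i = ⟨k, hkn⟩
          · rw [h, Function.update_self]
            omega
          · rw [Function.update_of_ne h]
            have : (i : ℕ) ≠ k := fun h' => h (Fin.ext h')
            have := htc i (by omega)
            omega
    -- No dent is left, so a further vertical lozenge would leave an up-pointing triangle unmatched.
    · have hall : ∀ i : Fin n, (i : ℕ) < k := fun i => by have := i.2; omega
      have hnS : ∀ j, c ≤ j → j < N → j ∉ S := by
        intro j hj hj' hjS
        obtain ⟨l, rfl⟩ := (hS j (hlo.trans hj) hj').1 hjS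
        exact absurd ((hk l).2 hj) (not_le.2 (hall l))
      rw [tilingGF_closedRow_eq_zero her hwt hBr' hcN hnS, mul_zero, ite_self, add_zero,
        if_neg (hnS c le_rfl hcN)]
      have := ih (N - (c + 1)) (by omega) k t (by omega) hcN (fun l => ?_) ht
        (fun i hi => by have := htc i hi; omega) rfl
      · rw [this]
        simp only [hall, if_true]
      · have h1 := hall l
        have h2 := mt (hk l).2 (not_le.2 h1)
        omega

end rows

/-! ### Peeling strips off the region -/

/-- The triangles of the strips between the heights `r` and `H` which lie between the `j`-axis and a
lattice line on the east. -/
noncomputable def upperRegion (W H r : ℤ) : Finset UnitTriangle :=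
  (Finset.Ico (0 : ℤ) (W - r) ×ˢ Finset.Ico r H).filter fun t => t.1 + t.2 < W

theorem mem_upperRegion {W H r : ℤ} {t : UnitTriangle} :
    t ∈ upperRegion W H r ↔ 0 ≤ t.1 ∧ r ≤ t.2 ∧ t.2 < H ∧ t.1 + t.2 < W := by
  simp only [upperRegion, Finset.mem_filter, Finset.mem_product, Finset.mem_Ico]
  constructor <;> intro h
  · tauto
  · refine ⟨⟨⟨h.1, ?_⟩, h.2.1, h.2.2.1⟩, h.2.2.2⟩
    omega

theorem openRow_union_upperRegion {W H r : ℤ} {N : ℕ} {S : Finset ℕ} (hr : r < H)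
    (hW : W - r = 2 * N) :
    openRow 0 r N 0 S ∪ upperRegion W H (r + 1) =
      upperRegion W H r \ S.image fun j : ℕ => (2 * (j : ℤ) + 1, r) := by
  ext ⟨a, b⟩
  simp only [Finset.mem_union, mem_openRow, mem_upperRegion, Finset.mem_sdiff, Finset.mem_image,
    Prod.mk.injEq, not_exists, not_and]
  constructor
  · rintro (⟨j, -, h2, ⟨rfl, rfl⟩ | ⟨h3, rfl, rfl⟩⟩ | h)
    · exact ⟨by omega, fun k _ => by omega⟩
    · refine ⟨by omega, fun k hk h => ?_⟩
      obtain rfl : j = k := by omega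
      contradiction
    · exact ⟨by omega, fun k _ => by omega⟩
  · rintro ⟨h, h'⟩
    by_cases hb : b = r
    · subst hb
      left
      rcases Int.even_or_odd' a with ⟨k, hk | hk⟩
      · exact ⟨k.toNat, by omega, by omega, Or.inl ⟨by omega, rfl⟩⟩
      · refine ⟨k.toNat, by omega, by omega, Or.inr ⟨fun hS => ?_, by omega, rfl⟩⟩
        exact h' k.toNat hS (by omega) rfl
    · right
      omega

theorem mem_closedRow {e r : ℤ} {N c : ℕ} {S : Finset ℕ} {t : UnitTriangle} :
    t ∈ closedRow e r N c S ↔ ∃ j : ℕ, c ≤ j ∧ j < N ∧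
      ((c < j ∧ t = (2 * (j : ℤ) + e, r)) ∨ (j ∉ S ∧ t = (2 * (j : ℤ) + e + 1, r))) := by
  simp only [closedRow, Finset.mem_union, Finset.mem_image, Finset.mem_Ico, Finset.mem_sdiff]
  constructor
  · rintro (⟨j, h, rfl⟩ | ⟨j, h, rfl⟩)
    exacts [⟨j, by omega, h.2, Or.inl ⟨h.1, rfl⟩⟩, ⟨j, h.1.1, h.1.2, Or.inr ⟨h.2, rfl⟩⟩]
  · rintro ⟨j, h1, h2, ⟨h3, rfl⟩ | ⟨h3, rfl⟩⟩
    exacts [Or.inl ⟨j, ⟨h3, h2⟩, rfl⟩, Or.inr ⟨j, ⟨⟨h1, h2⟩, h3⟩, rfl⟩]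

/-- At odd height the triangle `D_0` would be at abscissa `-1`, outside the zigzag, so the strip
begins with an up-pointing triangle. -/
theorem closedRow_union_upperRegion {W H r : ℤ} {N : ℕ} {S : Finset ℕ} (hr : r < H)
    (hW : W - r = 2 * N - 1) :
    closedRow (-1) r N 0 S ∪ upperRegion W H (r + 1) =
      upperRegion W H r \ S.image fun j : ℕ => (2 * (j : ℤ), r) := by
  ext ⟨a, b⟩
  simp only [Finset.mem_union, mem_closedRow, mem_upperRegion, Finset.mem_sdiff, Finset.mem_image,
    Prod.mk.injEq, not_exists, not_and]
  constructor
  · rintro (⟨j, -, h2, ⟨h3, rfl, rfl⟩ | ⟨h3, rfl, rfl⟩⟩ | h)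
    · exact ⟨by omega, fun k _ => by omega⟩
    · refine ⟨by omega, fun k hk h => ?_⟩
      obtain rfl : j = k := by omega
      contradiction
    · exact ⟨by omega, fun k _ => by omega⟩
  · rintro ⟨h, h'⟩
    by_cases hb : b = r
    · subst hb
      left
      rcases Int.even_or_odd' a with ⟨k, hk | hk⟩
      · refine ⟨k.toNat, by omega, by omega, Or.inr ⟨fun hS => ?_, by omega, rfl⟩⟩
        exact h' k.toNat hS (by omega) rfl
      · exact ⟨(k + 1).toNat, by omega, by omega, Or.inl ⟨by omega, by omega, rfl⟩⟩
    · right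
      omega

section steps

variable {K : Type*} [Field K] {wt : UnitTriangle × UnitTriangle → K} {W H r : ℤ} {N : ℕ}

/-- Peeling off a strip whose height above the base is even. -/
theorem tilingGF_evenRow (hr : Even r) (hrH : r < H) (hW : W - r = 2 * N)
    (hwt : ∀ L, L.1.1 ≠ L.2.1 → wt L = 1) {n : ℕ} (hn : 0 < n → r + 1 < H)
    {γ G : ℕ → Fin n → K} {C : K} (hG0 : G 0 = 0)
    (hG : ∀ c : ℕ, G (c + 1) = G c + wt ((2 * (c : ℤ), r), (2 * (c : ℤ), r + 1)) • γ c)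
    (hγ : ∀ t : Fin n → ℕ, StrictMono t → (∀ i, t i < N) →
      tilingGF (upperRegion W H (r + 1) \ Finset.univ.image fun i => (2 * (t i : ℤ), r + 1)) wt =
        C * (Matrix.of fun i => γ (t i)).det)
    {σ : Fin n → ℕ} (hσ : StrictMono σ) (hσN : ∀ i, σ i < N) :
    tilingGF (upperRegion W H r \ Finset.univ.image fun i => (2 * (σ i : ℤ) + 1, r)) wt =
      C * (Matrix.of fun i => G (σ i + 1)).det := by
  have h := tilingGF_openRow_eq_det (e := 0) (r := r) (N := N) (S := Finset.univ.image σ) (wt := wt)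
    (A := upperRegion W H (r + 1)) (by simpa using hr) hwt (lo := 0) hσ hσN (by simp)
    (fun t ht => by have := (mem_upperRegion.1 ht).2.1; omega)
    (fun c _ hc hn' => by
      have := hn hn'
      refine mem_upperRegion.2 ⟨?_, ?_, ?_, ?_⟩ <;> simp only <;> omega)
    (γ := γ) (G := G) (C := C) (fun c _ _ => by simpa using hG c)
    (fun t ht htN => by simpa using hγ t ht fun i => (htN i).2)
    -- No vertical lozenge is placed yet, so the values of `fun _ => 0` are never used.
    (c := 0) 0 (fun _ => 0) le_rfl (Nat.zero_le _) (by simp) (by simp) (by simp)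
  rw [Finset.filter_false_of_mem (by simp), Finset.image_empty, Finset.sdiff_empty,
    openRow_union_upperRegion hrH hW, Finset.image_image] at h
  simpa [hG0, Function.comp_def] using h

/-- Peeling off a strip whose height above the base is odd. -/
theorem tilingGF_oddRow (hr : Odd r) (hrH : r < H) (hW : W - r = 2 * N - 1)
    (hwt : ∀ L, L.1.1 ≠ L.2.1 → wt L = 1) {n : ℕ} (hn : 0 < n → r + 1 < H)
    {γ G : ℕ → Fin n → K} {C : K}
    (hG : ∀ c : ℕ, G (c + 1) = G c + wt ((2 * (c : ℤ) + 1, r), (2 * (c : ℤ) + 1, r + 1)) • γ c)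
    (hγ : ∀ σ : Fin n → ℕ, StrictMono σ → (∀ i, σ i + 1 < N) →
      tilingGF (upperRegion W H (r + 1) \
        Finset.univ.image fun i => (2 * (σ i : ℤ) + 1, r + 1)) wt =
        C * (Matrix.of fun i => γ (σ i)).det)
    {t : Fin (n + 1) → ℕ} (ht : StrictMono t) (htN : ∀ i, t i < N) :
    tilingGF (upperRegion W H r \ Finset.univ.image fun i => (2 * (t i : ℤ), r)) wt =
      C * (Matrix.of fun i : Fin n => G (t i.succ) - G (t 0)).det := by
  have hup : ∀ u ∈ upperRegion W H (r + 1), r < u.2 := fun u hu => by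
    have := (mem_upperRegion.1 hu).2.1
    omega
  have her : Even (-1 + r) := by
    obtain ⟨k, rfl⟩ := hr
    exact ⟨k, by ring⟩
  -- Everything up to the first dent `t 0` is forced, so the sweep starts at `t 0 + 1` with the
  -- remaining dents `t i.succ`.
  have h := tilingGF_openRow_eq_det (e := -1) (r := r) (N := N) (S := Finset.univ.image t)
    (wt := wt) (A := upperRegion W H (r + 1)) her hwt (lo := t 0 + 1) (σ := fun i => t i.succ)
    (fun i j hij => ht (Fin.succ_lt_succ_iff.2 hij)) (fun i => htN _)
    (fun j hj _ => by
      simp only [Finset.mem_image, Finset.mem_univ, true_and]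
      constructor
      · rintro ⟨i, rfl⟩
        cases i using Fin.cases with
        | zero => omega
        | succ i => exact ⟨i, rfl⟩
      · rintro ⟨i, rfl⟩
        exact ⟨_, rfl⟩)
    hup
    (fun c hc0 hc hn' => by
      have := hn hn'
      refine mem_upperRegion.2 ⟨?_, ?_, ?_, ?_⟩ <;> simp only <;> omega)
    -- `D_c` has abscissa `2 * c - 1 = 2 * (c - 1) + 1`. The truncated subtraction is harmless, as
    -- `c ≥ t 0 + 1`.
    (γ := fun c => γ (c - 1)) (G := fun c => G (c - 1)) (C := C)
    (fun c hc _ => by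
      obtain ⟨d, rfl⟩ : ∃ d, c = d + 1 := ⟨c - 1, by omega⟩
      have e1 : 2 * ((d + 1 : ℕ) : ℤ) + -1 = 2 * (d : ℤ) + 1 := by push_cast; ring
      rw [e1]
      exact hG d)
    (fun u hu huN => by
      have e1 : ∀ i, 2 * (u i : ℤ) + -1 = 2 * ((u i - 1 : ℕ) : ℤ) + 1 := fun i => by
        have := (huN i).1
        omega
      simp only [e1]
      refine hγ (fun i => u i - 1) (fun i j hij => ?_) fun i => ?_
      · have := hu hij
        have := (huN i).1
        simp only
        omega
      · have := huN i
        omega)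
    (c := t 0 + 1) 0 (fun _ => 0) le_rfl (htN 0)
    (fun l => by
      have : t 0 < t l.succ := ht (Fin.succ_pos l)
      simp only [Nat.zero_le, true_iff]
      exact this)
    (by simp) (by simp)
  rw [Finset.filter_false_of_mem (by simp), Finset.image_empty, Finset.sdiff_empty,
    ← tilingGF_closedRow (c := 0) (p := t 0) her hwt hup (Nat.zero_le _) (htN 0) (by simp)
      (fun j _ hj hjS => by
        obtain ⟨i, -, rfl⟩ := Finset.mem_image.1 hjS
        exact absurd (ht.monotone (Fin.zero_le i)) (not_le.2 hj)),
    closedRow_union_upperRegion hrH hW, Finset.image_image] at h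
  simpa [Function.comp_def] using h

end steps

/-! ### Product-to-sum formulas and partial sums of the columns -/

section qfunctions

variable {K : Type*} [Field K]

/-- `q ^ k + q ^ (-k)`. -/
def qCosh (q : K) (k : ℤ) : K := q ^ k + q ^ (-k)

/-- `q ^ k - q ^ (-k)`. -/
def qSinh (q : K) (k : ℤ) : K := q ^ k - q ^ (-k)

variable {q : K}

theorem qSinh_zero : qSinh q 0 = 0 := by simp [qSinh]

theorem qCosh_zero : qCosh q 0 = 2 := by simp [qCosh, one_add_one_eq_two]

theorem qSinh_neg (k : ℤ) : qSinh q (-k) = -qSinh q k := by simp [qSinh]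

theorem qCosh_mul_qSinh (hq : q ≠ 0) (a b : ℤ) :
    qCosh q a * qSinh q b = qSinh q (b + a) + qSinh q (b - a) := by
  simp only [qCosh, qSinh, sub_eq_add_neg, neg_add, zpow_add₀ hq, neg_neg]
  ring

theorem qCosh_mul_qCosh (hq : q ≠ 0) (a b : ℤ) :
    qCosh q a * qCosh q b = qCosh q (b + a) + qCosh q (b - a) := by
  simp only [qCosh, sub_eq_add_neg, neg_add, zpow_add₀ hq, neg_neg]
  ring

theorem qSinh_mul_qSinh (hq : q ≠ 0) (a b : ℤ) :
    qSinh q a * qSinh q b = qCosh q (b + a) - qCosh q (b - a) := by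
  simp only [qCosh, qSinh, sub_eq_add_neg, neg_add, zpow_add₀ hq, neg_neg]
  ring

/-- Column factors of the determinants on the lines of odd height. -/
def oddFactor (q : K) (j : ℕ) : K := if j = 0 then 1 / 2 else 1 / (2 * qSinh q (2 * j))

/-- Column factors of the determinants on the lines of even height. -/
def evenFactor (q : K) (j : ℕ) : K :=
  if j = 0 then 1 / qSinh q 1 else 1 / (2 * qSinh q (2 * j + 1))

theorem wt₂_of_ne {L : UnitTriangle × UnitTriangle} (h : L.1.1 ≠ L.2.1) : wt₂ q L = 1 := by
  simp [wt₂, h]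

theorem wt₂_vertical {a r r' : ℤ} (h : a ≠ 0) : wt₂ q ((a, r), (a, r')) = qCosh q a / 2 := by
  simp [wt₂, h, qCosh]

theorem wt₂_vertical_zero {r r' : ℤ} : wt₂ q ((0, r), (0, r')) = 1 / 2 := by
  simp [wt₂]

/-- The partial sums of `qSinh q ((2 * j + 1) * (2 * d + 1))` against the weights of the vertical
lozenges at `2 * d + 1`. -/
def oddSum (q : K) (d j : ℕ) : K :=
  (qCosh q (4 * (j + 1) * d) / qSinh q (2 * (j + 1)) + qCosh q (4 * j * d) / qSinh q (2 * j)) / 2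

/-- The partial sums of `qCosh q (4 * j * d)` against the weights of the vertical lozenges
at `2 * d`. -/
def evenSum (q : K) (c j : ℕ) : K :=
  if c = 0 then 0 else
    (qSinh q ((2 * j + 1) * (2 * c - 1)) / qSinh q (2 * j + 1) +
      qSinh q ((2 * j - 1) * (2 * c - 1)) / qSinh q (2 * j - 1)) / 2

/-- The product `C * S` is a sum of two values of `S`, and each telescopes after multiplication by
`S (2 * i)`, for `i = j` and `i = j + 1`. The value at `d = 0` is immaterial, because only
differences of `oddSum` are used. -/
theorem oddSum_succ (hq : q ≠ 0) (hs : ∀ k : ℤ, k ≠ 0 → qSinh q k ≠ 0) (d j : ℕ) :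
    oddSum q (d + 1) j =
      oddSum q d j + qCosh q (2 * d + 1) / 2 * qSinh q ((2 * j + 1) * (2 * d + 1)) := by
  have key : ∀ i : ℕ, qCosh q (4 * i * (d + 1)) / qSinh q (2 * i) =
      qCosh q (4 * i * d) / qSinh q (2 * i) + qSinh q (2 * i * (2 * d + 1)) := by
    intro i
    -- For `i = 0` both quotients have denominator `S 0 = 0` and are `0` by convention, as is the
    -- summand.
    rcases Nat.eq_zero_or_pos i with rfl | hi
    · simp [qSinh_zero]
    · have h := hs (2 * i) (by omega)
      have h2 := qSinh_mul_qSinh hq (2 * i) (2 * i * (2 * d + 1))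
      rw [show (2 * i * (2 * d + 1) + 2 * i : ℤ) = 4 * i * (d + 1) by ring,
        show (2 * i * (2 * d + 1) - 2 * i : ℤ) = 4 * i * d by ring] at h2
      field_simp
      rw [mul_comm (qSinh q _), mul_comm (qSinh q _)] at *
      linear_combination -h2
  have h1 := key j
  have h2 := key (j + 1)
  have h3 := qCosh_mul_qSinh hq (2 * d + 1) ((2 * j + 1) * (2 * d + 1))
  rw [show ((2 * j + 1) * (2 * d + 1) + (2 * d + 1) : ℤ) = 2 * (j + 1) * (2 * d + 1) by ring,
    show ((2 * j + 1) * (2 * d + 1) - (2 * d + 1) : ℤ) = 2 * j * (2 * d + 1) by ring] at h3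
  simp only [oddSum]
  push_cast at *
  rw [h1, h2]
  linear_combination -h3 / 2

theorem evenSum_succ (hq : q ≠ 0) (hs : ∀ k : ℤ, k ≠ 0 → qSinh q k ≠ 0) (h2 : (2 : K) ≠ 0)
    (r r' : ℤ) (c j : ℕ) :
    evenSum q (c + 1) j = evenSum q c j +
      wt₂ q ((2 * (c : ℤ), r), (2 * (c : ℤ), r')) * qCosh q (4 * j * c) := by
  -- The quotient formula would give `-1` at `c = 0`, and the weight `C 0 / 2 = 1` an increment of
  -- `2`. With weight `1 / 2` the increment is `1`, so the sums start at `0` and still reach the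
  -- formula's value `1` at `c = 1`.
  rcases Nat.eq_zero_or_pos c with rfl | hc
  · have e1 := hs (2 * j + 1) (by omega)
    have e2 := hs (2 * j - 1) (by omega)
    simp only [evenSum, Nat.cast_zero, mul_zero, wt₂_vertical_zero, qCosh_zero]
    norm_num
    rw [div_self e1, div_self e2]
    field_simp
    norm_num
  · have key : ∀ i : ℤ, i ≠ 0 → qSinh q (i * (2 * c + 1)) / qSinh q i =
        qSinh q (i * (2 * c - 1)) / qSinh q i + qCosh q (i * (2 * c)) := by
      intro i hi
      have h := hs i hi
      have h3 := qCosh_mul_qSinh hq (i * (2 * c)) i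
      rw [show (i + i * (2 * c) : ℤ) = i * (2 * c + 1) by ring,
        show (i - i * (2 * c) : ℤ) = -(i * (2 * c - 1)) by ring, qSinh_neg] at h3
      field_simp
      linear_combination -h3
    have k1 := key (2 * j + 1) (by omega)
    have k2 := key (2 * j - 1) (by omega)
    have h3 := qCosh_mul_qCosh hq (2 * c) (4 * j * c)
    rw [show (4 * j * c + 2 * c : ℤ) = (2 * j + 1) * (2 * c) by ring,
      show (4 * j * c - 2 * c : ℤ) = (2 * j - 1) * (2 * c) by ring] at h3
    rw [evenSum, evenSum, if_neg (by omega), if_neg (by omega), wt₂_vertical (by omega)]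
    have e : (2 * ((c + 1 : ℕ) : ℤ) - 1) = 2 * c + 1 := by push_cast; ring
    rw [e, k1, k2]
    linear_combination -h3 / 2

/-- Subtract row `0` from the others and expand along the column of ones. -/
theorem det_cons_one_eq {n : ℕ} (G : Fin (n + 1) → Fin n → K) :
    (Matrix.of fun i j : Fin n => G i.succ j - G 0 j).det =
      (Matrix.of fun i : Fin (n + 1) => (Fin.cons 1 (G i) : Fin (n + 1) → K)).det := by
  set B : Matrix (Fin (n + 1)) (Fin (n + 1)) K :=
    Matrix.of fun i => if i = 0 then Fin.cons 1 (G 0) else Fin.cons 0 (G i - G 0) with hB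
  have h : (Matrix.of fun i : Fin (n + 1) => (Fin.cons 1 (G i) : Fin (n + 1) → K)).det = B.det := by
    refine Matrix.det_eq_of_forall_row_eq_smul_add_const (fun i => if i = 0 then 0 else 1) 0
      (by simp) ?_
    intro i j
    by_cases hi : i = 0
    · simp [hi, hB]
    · cases j using Fin.cases <;> simp [hi, hB]
  rw [h, Matrix.det_succ_column_zero, Fin.sum_univ_succ, Finset.sum_eq_zero]
  · simp [hB]
    congr 1
  · intro i _
    simp [hB]

theorem det_oddSum (hs : ∀ k : ℤ, k ≠ 0 → qSinh q k ≠ 0) (h2 : (2 : K) ≠ 0) {n : ℕ}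
    (t : Fin (n + 1) → ℕ) :
    (Matrix.of fun i j : Fin n => oddSum q (t i.succ) j - oddSum q (t 0) j).det =
      (∏ j : Fin (n + 1), oddFactor q j) *
        (Matrix.of fun i j : Fin (n + 1) => qCosh q (4 * (j : ℕ) * t i)).det := by
  rw [det_cons_one_eq fun i j => oddSum q (t i) j, ← Matrix.det_mul_row]
  symm
  -- After scaling by `oddFactor`, the column of `oddSum` with index `j` is the sum of the scaled
  -- columns `j + 1` and `j`. For `j = 0` the second one is absent, its denominator being `S 0`; the
  -- scaled column `0` is the column of ones, as `C 0 = 2`.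
  refine Matrix.det_eq_of_forall_col_eq_smul_add_pred
    (fun j => if (j : ℕ) = 0 then 0 else -1) ?_ ?_
  · intro i
    simp [oddFactor, qCosh_zero, h2]
  · intro i j
    have e1 := hs (2 * ((j : ℕ) + 1)) (by omega)
    by_cases hj : (j : ℕ) = 0
    · simp [oddFactor, oddSum, hj, qSinh_zero]
      field_simp
    · have e2 := hs (2 * (j : ℕ)) (by omega)
      have hj' : j.castSucc ≠ 0 := fun h => hj (congrArg Fin.val h)
      simp [oddFactor, oddSum, hj, hj']
      field_simp
      ring

theorem det_evenSum (hs : ∀ k : ℤ, k ≠ 0 → qSinh q k ≠ 0) (h2 : (2 : K) ≠ 0) {n : ℕ}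
    (σ : Fin (n + 1) → ℕ) :
    (Matrix.of fun i j : Fin (n + 1) => evenSum q (σ i + 1) j).det =
      (∏ j : Fin (n + 1), evenFactor q j) *
        (Matrix.of fun i j : Fin (n + 1) => qSinh q ((2 * (j : ℕ) + 1) * (2 * σ i + 1))).det := by
  rw [← Matrix.det_mul_row]
  symm
  have e0 := hs 1 one_ne_zero
  have e : ∀ i, (2 * ((σ i + 1 : ℕ) : ℤ) - 1) = 2 * σ i + 1 := fun i => by push_cast; ring
  -- For `j = 0` the two quotients in `evenSum` coincide because `S` is odd. So the scaled column
  -- `0` has no factor `1 / 2`, and only half of it is subtracted from the next column.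
  refine Matrix.det_eq_of_forall_col_eq_smul_add_pred
    (fun j => if (j : ℕ) = 0 then -1 / 2 else -1) ?_ ?_
  · intro i
    simp only [Matrix.of_apply, evenSum, e, Fin.val_zero, evenFactor]
    have e3 : (-1 + -(2 * σ i) : ℤ) = -(2 * σ i + 1) := by ring
    simp [qSinh_neg]
    rw [e3, qSinh_neg, neg_div_neg_eq, ← add_div]
    field_simp
    norm_num
  · intro i j
    simp only [Matrix.of_apply, evenSum, e, evenFactor]
    have e1 := hs (2 * ((j : ℕ) + 1) + 1) (by omega)
    have e3 : (2 * ((j : ℤ) + 1) - 1) = 2 * (j : ℕ) + 1 := by ring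
    by_cases hj : (j : ℕ) = 0
    · simp [hj]
      field_simp
      ring
    · have e2 := hs (2 * (j : ℕ) + 1) (by omega)
      simp [hj, e3]
      field_simp
      ring

end qfunctions

/-! ### Iteration over the strips and evaluation of the determinant -/

section product

variable {K : Type*} [Field K] {q : K}

/-- The factor by which the constant grows when two strips are added. -/
def stepFactor (q : K) (m : ℕ) : K :=
  (∏ j : Fin (m + 1), oddFactor q j) * ∏ j : Fin (m + 1), evenFactor q j

/-- Here `m` counts pairs of strips from the top; the induction adds a pair at the bottom. The empty
region gives the empty determinant. -/
theorem tilingGF_upperRegion_sdiff (hq : q ≠ 0) (hs : ∀ k : ℤ, k ≠ 0 → qSinh q k ≠ 0)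
    (h2 : (2 : K) ≠ 0) (x n m : ℕ) (hm : m ≤ n) (σ : Fin m → ℕ) (hσ : StrictMono σ)
    (hσN : ∀ i, σ i < x + m) :
    tilingGF (upperRegion (2 * (x + n)) (2 * n) (2 * (n - m)) \
        Finset.univ.image fun i => (2 * (σ i : ℤ) + 1, 2 * ((n : ℤ) - m))) (wt₂ q) =
      (∏ k ∈ Finset.range m, stepFactor q k) *
        (Matrix.of fun i j : Fin m => qSinh q ((2 * (j : ℕ) + 1) * (2 * σ i + 1))).det := by
  induction m with
  | zero =>
    have : upperRegion (2 * (x + n)) (2 * n) (2 * (n - (0 : ℕ))) = ∅ := by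
      refine Finset.eq_empty_of_forall_notMem fun t ht => ?_
      have := mem_upperRegion.1 ht
      push_cast at this
      omega
    simp only [this, Finset.empty_sdiff, tilingGF_empty]
    simp
  | succ m ih =>
    have hr : (2 * ((n : ℤ) - (m + 1 : ℕ))) + 1 + 1 = 2 * (n - m) := by push_cast; ring
    have hne : ∀ L : UnitTriangle × UnitTriangle, L.1.1 ≠ L.2.1 → wt₂ q L = 1 :=
      fun L => wt₂_of_ne
    -- The upper strip of the new pair: `m + 1` dents below but `m` vertical lozenges above, so the
    -- determinant grows by one row and column.
    have hodd : ∀ t : Fin (m + 1) → ℕ, StrictMono t → (∀ i, t i < x + (m + 1)) →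
        tilingGF (upperRegion (2 * (x + n)) (2 * n) (2 * (n - (m + 1 : ℕ)) + 1) \
          Finset.univ.image fun i => (2 * (t i : ℤ), 2 * ((n : ℤ) - (m + 1 : ℕ)) + 1)) (wt₂ q) =
        ((∏ k ∈ Finset.range m, stepFactor q k) * ∏ j : Fin (m + 1), oddFactor q j) *
          (Matrix.of fun i j : Fin (m + 1) => qCosh q (4 * (j : ℕ) * t i)).det := by
      intro t ht htN
      rw [mul_assoc, ← det_oddSum hs h2 t]
      refine tilingGF_oddRow (N := x + (m + 1)) ⟨_, rfl⟩ (by omega) (by push_cast; ring) hne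
        (by intro; omega)
        (γ := fun c (j : Fin m) => qSinh q ((2 * (j : ℕ) + 1) * (2 * c + 1)))
        (G := fun c (j : Fin m) => oddSum q c j) ?_ ?_ ht htN
      · intro c
        ext j
        rw [wt₂_vertical (by omega)]
        exact oddSum_succ hq hs c j
      · intro σ hσ hσN
        rw [hr]
        exact ih (by omega) σ hσ fun i => by have := hσN i; omega
    have hstep := tilingGF_evenRow (W := 2 * (x + n)) (H := 2 * n)
      (r := 2 * (n - (m + 1 : ℕ))) (N := x + (m + 1)) (even_two_mul _) (by omega)
      (by push_cast; ring) hne (n := m + 1) (by intro; omega)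
      (γ := fun c (j : Fin (m + 1)) => qCosh q (4 * (j : ℕ) * c))
      (G := fun c (j : Fin (m + 1)) => evenSum q c j)
      (by ext j; simp [evenSum])
      (fun c => by
        ext j
        exact evenSum_succ hq hs h2 _ _ c j)
      hodd hσ hσN
    rw [hstep]
    have := det_evenSum hs h2 σ
    rw [Finset.prod_range_succ, stepFactor, ← mul_assoc, mul_assoc _ (∏ j, evenFactor q _), ← this]

open Polynomial in
/-- The monic polynomial of degree `j` which takes `q ^ 2 + q ^ (-2)` to
`(q ^ (2 * j + 1) - q ^ (-(2 * j + 1))) / (q - q⁻¹)`. -/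
noncomputable def oddPoly (K : Type*) [Field K] : ℕ → K[X]
  | 0 => 1
  | 1 => X + 1
  | j + 2 => X * oddPoly K (j + 1) - oddPoly K j

open Polynomial in
theorem oddPoly_monic_natDegree (j : ℕ) : (oddPoly K j).Monic ∧ (oddPoly K j).natDegree = j := by
  induction j using Nat.twoStepInduction with
  | zero => simp [oddPoly]
  | one =>
    have : oddPoly K 1 = X + C 1 := by simp [oddPoly]
    rw [this]
    exact ⟨monic_X_add_C 1, natDegree_X_add_C 1⟩
  | more j ih1 ih2 =>
    have hm : (X * oddPoly K (j + 1)).Monic := monic_X.mul ih2.1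
    have hd : (X * oddPoly K (j + 1)).natDegree = j + 2 := by
      rw [natDegree_X_mul ih2.1.ne_zero, ih2.2]
    have hlt : (oddPoly K j).natDegree < (X * oddPoly K (j + 1)).natDegree := by
      rw [hd, ih1.2]
      omega
    exact ⟨hm.sub_of_left (degree_lt_degree hlt),
      (natDegree_sub_eq_left_of_natDegree_lt hlt).trans hd⟩

theorem eval_oddPoly (hq : q ≠ 0) (u : ℤ) (j : ℕ) :
    qSinh q u * (oddPoly K j).eval (qCosh q (2 * u)) = qSinh q ((2 * j + 1) * u) := by
  induction j using Nat.twoStepInduction with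
  | zero => simp [oddPoly]
  | one =>
    have h := qCosh_mul_qSinh hq (2 * u) u
    rw [show u - 2 * u = -u by ring, qSinh_neg] at h
    simp only [oddPoly, Polynomial.eval_add, Polynomial.eval_X, Polynomial.eval_one]
    rw [show (2 * ((1 : ℕ) : ℤ) + 1) * u = u + 2 * u by push_cast; ring]
    linear_combination h
  | more j ih1 ih2 =>
    have h := qCosh_mul_qSinh hq (2 * u) ((2 * (j + 1 : ℕ) + 1) * u)
    rw [show (2 * ((j + 1 : ℕ) : ℤ) + 1) * u - 2 * u = (2 * j + 1) * u by push_cast; ring,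
      show (2 * ((j + 1 : ℕ) : ℤ) + 1) * u + 2 * u = (2 * (j + 2 : ℕ) + 1) * u by
        push_cast; ring] at h
    simp only [oddPoly, Polynomial.eval_sub, Polynomial.eval_mul, Polynomial.eval_X]
    linear_combination h - ih1 + qCosh q (2 * u) * ih2

/-- Row `i` is `S (u i)` times the values of monic polynomials of degrees `0, 1, …` at `C (2 * u
i)`, which leaves a Vandermonde determinant. Its differences factor as `C (2b) - C (2a) = S (b + a)
* S (b - a)`. -/
theorem det_qSinh (hq : q ≠ 0) {n : ℕ} (u : Fin n → ℤ) :
    (Matrix.of fun i j : Fin n => qSinh q ((2 * (j : ℕ) + 1) * u i)).det =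
      (∏ i, qSinh q (u i)) *
        ∏ i, ∏ j ∈ Finset.Ioi i, (qSinh q (u j + u i) * qSinh q (u j - u i)) := by
  simp only [← eval_oddPoly hq]
  have h := Matrix.det_mul_column (fun i => qSinh q (u i))
    (Matrix.of fun i j : Fin n => (oddPoly K j).eval (qCosh q (2 * u i)))
  simp only [Matrix.of_apply] at h
  rw [h, ← Matrix.det_eval_matrixOfPolynomials_eq_det_vandermonde (fun i => qCosh q (2 * u i))
    (fun j : Fin n => oddPoly K j) (fun j => (oddPoly_monic_natDegree _).2)
    (fun j => (oddPoly_monic_natDegree _).1), Matrix.det_vandermonde]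
  congr 1
  refine Finset.prod_congr rfl fun i _ => Finset.prod_congr rfl fun j _ => ?_
  rw [qSinh_mul_qSinh hq]
  have e1 : u j - u i + (u j + u i) = 2 * u j := by ring
  have e2 : u j - u i - (u j + u i) = -(2 * u i) := by ring
  rw [e1, e2, sub_right_inj]
  simp [qCosh, add_comm]

/-- The factors `S (2j)` of the odd lines and `S (2j+1)` of the even lines interleave to a full
factorial. -/
theorem stepFactor_eq (m : ℕ) :
    stepFactor q m = ((2 : K) ^ (2 * m + 1) *
      ∏ k ∈ Finset.Icc 1 (2 * m + 1), qSinh q (k : ℕ))⁻¹ := by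
  induction m with
  | zero => simp [stepFactor, oddFactor, evenFactor, mul_comm]
  | succ m ih =>
    have h : stepFactor q (m + 1) =
        stepFactor q m * (oddFactor q (m + 1) * evenFactor q (m + 1)) := by
      simp only [stepFactor, Fin.prod_univ_castSucc (n := m + 1), Fin.val_castSucc, Fin.val_last]
      ring
    have hp : ∏ k ∈ Finset.Icc 1 (2 * (m + 1) + 1), qSinh q (k : ℕ) =
        (∏ k ∈ Finset.Icc 1 (2 * m + 1), qSinh q (k : ℕ)) * qSinh q (2 * (m + 1)) *
          qSinh q (2 * (m + 1) + 1) := by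
      rw [Finset.prod_Icc_succ_top (by omega), show 2 * (m + 1) = 2 * m + 1 + 1 by ring,
        Finset.prod_Icc_succ_top (by omega)]
      push_cast
      rw [show (2 * (m : ℤ) + 1 + 1) = 2 * (m + 1) by ring]
    rw [h, ih, hp]
    simp only [oddFactor, evenFactor, if_neg (Nat.succ_ne_zero m)]
    push_cast
    generalize (2 : K) = z
    simp only [mul_inv, one_div]
    ring

end product

/-! ### Reindexing finite products -/

section finiteProducts

variable {M : Type*} [CommMonoid M]

theorem prod_fin_add_one (n : ℕ) (f : ℕ → M) :
    ∏ i : Fin n, f (i + 1) = ∏ i ∈ Finset.Icc 1 n, f i := by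
  induction n with
  | zero => simp
  | succ n ih => rw [Fin.prod_univ_castSucc, Finset.prod_Icc_succ_top (by omega), ← ih]; simp

theorem prod_fin_Ioi_add_one (n : ℕ) (f : ℕ → ℕ → M) :
    ∏ i : Fin n, ∏ j ∈ Finset.Ioi i, f (i + 1) (j + 1) =
      ∏ i ∈ Finset.Icc 1 n, ∏ j ∈ Finset.Ioc i n, f i j := by
  rw [← prod_fin_add_one]
  refine Finset.prod_congr rfl fun i _ => ?_
  refine Finset.prod_bij (fun j _ => (j : ℕ) + 1) ?_ ?_ ?_ ?_
  · intro j hj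
    have : (i : ℕ) < j := Fin.lt_def.1 (Finset.mem_Ioi.1 hj)
    rw [Finset.mem_Ioc]
    omega
  · intro j _ k _ h
    exact Fin.ext (by omega)
  · intro j hj
    rw [Finset.mem_Ioc] at hj
    exact ⟨⟨j - 1, by omega⟩, Finset.mem_Ioi.2 (Fin.lt_def.2 (by simp only; omega)),
      by simp only; omega⟩
  · intro j _
    rfl

theorem prod_Icc_Ioc_succ (n : ℕ) (f : ℕ → ℕ → M) :
    ∏ i ∈ Finset.Icc 1 (n + 1), ∏ j ∈ Finset.Ioc i (n + 1), f i j =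
      (∏ i ∈ Finset.Icc 1 n, ∏ j ∈ Finset.Ioc i n, f i j) *
        ∏ i ∈ Finset.Icc 1 n, f i (n + 1) := by
  rw [Finset.prod_Icc_succ_top (by omega), Finset.Ioc_self, Finset.prod_empty, mul_one,
    ← Finset.prod_mul_distrib]
  refine Finset.prod_congr rfl fun i hi => ?_
  rw [Finset.prod_Ioc_succ_top (Finset.mem_Icc.1 hi).2]

theorem prod_Icc_Icc_succ (n : ℕ) (f : ℕ → ℕ → M) :
    ∏ i ∈ Finset.Icc 1 (n + 1), ∏ j ∈ Finset.Icc i (n + 1), f i j =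
      (∏ i ∈ Finset.Icc 1 n, ∏ j ∈ Finset.Icc i n, f i j) *
        ((∏ i ∈ Finset.Icc 1 n, f i (n + 1)) * f (n + 1) (n + 1)) := by
  rw [Finset.prod_Icc_succ_top (by omega), Finset.Icc_self, Finset.prod_singleton, ← mul_assoc,
    ← Finset.prod_mul_distrib]
  congr 1
  refine Finset.prod_congr rfl fun i hi => ?_
  have := (Finset.mem_Icc.1 hi).2
  rw [Finset.prod_Icc_succ_top (by omega)]

end finiteProducts

/-! ### From `qSinh` to `q`-integers -/

section qInt

variable {K : Type*} [Field K] {q : K}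

theorem qInt_sq (hq : q ≠ 0) (h1 : qSinh q 1 ≠ 0) (m : ℕ) :
    qInt (q ^ 2) m = q ^ ((m : ℤ) - 1) * qSinh q m / qSinh q 1 := by
  have h := geom_sum_mul (q ^ 2) m
  have e1 : q * qSinh q 1 = q ^ 2 - 1 := by
    simp only [qSinh, zpow_neg, zpow_one]
    field_simp
  have e2 : q ^ m * qSinh q m = (q ^ 2) ^ m - 1 := by
    simp only [qSinh, zpow_neg, zpow_natCast, mul_sub]
    rw [mul_inv_cancel₀ (pow_ne_zero _ hq)]
    ring
  rw [eq_div_iff h1, zpow_sub₀ hq, zpow_natCast, zpow_one, qInt, div_mul_eq_mul_div, e2, ← h, ← e1]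
  field_simp

theorem qFactorial_sq (hq : q ≠ 0) (h1 : qSinh q 1 ≠ 0) (n : ℕ) :
    qFactorial (q ^ 2) (2 * n + 1) = q ^ ((n : ℤ) * (2 * n + 1)) *
      (∏ k ∈ Finset.Icc 1 (2 * n + 1), qSinh q (k : ℕ)) / qSinh q 1 ^ (2 * n + 1) := by
  have h : ∀ m : ℕ, qFactorial (q ^ 2) m * qSinh q 1 ^ m =
      (∏ k ∈ Finset.Icc 1 m, q ^ ((k : ℤ) - 1)) * ∏ k ∈ Finset.Icc 1 m, qSinh q (k : ℕ) := by
    intro m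
    rw [qFactorial, ← Finset.prod_mul_distrib]
    induction m with
    | zero => simp
    | succ m ih =>
      rw [Finset.prod_Icc_succ_top (by omega), Finset.prod_Icc_succ_top (by omega), ← ih,
        qInt_sq hq h1, pow_succ (qSinh q 1)]
      field_simp
  have h' : ∏ k ∈ Finset.Icc 1 (2 * n + 1), q ^ ((k : ℤ) - 1) = q ^ ((n : ℤ) * (2 * n + 1)) := by
    induction n with
    | zero => simp
    | succ n ih =>
      rw [show 2 * (n + 1) + 1 = 2 * n + 1 + 1 + 1 by ring, Finset.prod_Icc_succ_top (by omega),
        Finset.prod_Icc_succ_top (by omega), ih, ← zpow_add₀ hq, ← zpow_add₀ hq]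
      congr 1
      push_cast
      ring
  rw [eq_div_iff (pow_ne_zero _ h1), h, h']

/-- The three groups are the denominators `[i + j - 1]` with `i < j`, `[2 * j - 1]` on the diagonal,
and `[j - i]`, for `j = n + 1`; this drives the induction in `prod_qInt_eq`. -/
theorem qFactorial_two_mul_add_one (p : K) (n : ℕ) :
    qFactorial p (2 * n + 1) = (∏ i ∈ Finset.Icc 1 n, qInt p (i + (n + 1) - 1)) *
      qInt p (2 * n + 1) * ∏ i ∈ Finset.Icc 1 n, qInt p (n + 1 - i) := by
  have h1 : ∏ i ∈ Finset.Icc 1 n, qInt p (n + 1 - i) = ∏ k ∈ Finset.Icc 1 n, qInt p k := by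
    refine Finset.prod_bij' (fun i _ => n + 1 - i) (fun i _ => n + 1 - i) ?_ ?_ ?_ ?_ ?_ <;>
      simp only [Finset.mem_Icc] <;> intros <;> first | omega | rfl | trivial
  have h2 : ∀ m, qFactorial p (n + m) = (∏ k ∈ Finset.Icc 1 n, qInt p k) *
      ∏ i ∈ Finset.Icc 1 m, qInt p (i + (n + 1) - 1) := by
    intro m
    induction m with
    | zero => simp [qFactorial]
    | succ m ih =>
      rw [Finset.prod_Icc_succ_top (by omega), ← mul_assoc, ← ih, qFactorial, ← add_assoc,
        Finset.prod_Icc_succ_top (by omega), qFactorial,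
        show m + 1 + (n + 1) - 1 = n + m + 1 by omega]
  rw [h1, qFactorial, Finset.prod_Icc_succ_top (by omega), two_mul]
  change qFactorial p (n + n) * _ = _
  rw [h2]
  ring

/-- In the product of the two factors the power of `q` no longer depends on the smaller entry `a`.
-/
theorem qInt_mul_qInt_sq (hq : q ≠ 0) (h1 : qSinh q 1 ≠ 0) {a b : ℕ} (ha : 1 ≤ a) (hab : a ≤ b) :
    qInt (q ^ 2) (2 * (a + b - 1)) * qInt (q ^ 2) (2 * (b - a)) =
      q ^ (4 * (b : ℤ) - 4) *
        (qSinh q (2 * (a + b - 1)) * qSinh q (2 * (b - a))) / qSinh q 1 ^ 2 := by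
  rw [qInt_sq hq h1, qInt_sq hq h1]
  have e1 : ((2 * (a + b - 1) : ℕ) : ℤ) = 2 * (a + b - 1) := by omega
  have e2 : ((2 * (b - a) : ℕ) : ℤ) = 2 * (b - a) := by omega
  rw [e1, e2, show (4 * b - 4 : ℤ) = (2 * (a + b - 1) - 1) + (2 * (b - a) - 1) by ring,
    zpow_add₀ hq]
  field_simp

/-- The product formula in terms of `qSinh`, rewritten with `q`-integers. -/
theorem prod_qSinh_eq_qInt (hq : q ≠ 0) (hs : ∀ k : ℤ, k ≠ 0 → qSinh q k ≠ 0) (h2 : (2 : K) ≠ 0)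
    (n : ℕ) (s : ℕ → ℕ) (hs1 : ∀ i ∈ Set.Icc 1 n, 1 ≤ s i)
    (hmono : MonotoneOn s (Set.Icc 1 n)) :
    (∏ k ∈ Finset.range n, stepFactor q k) *
      ((∏ i ∈ Finset.Icc 1 n, qSinh q (2 * s i - 1)) *
        ∏ i ∈ Finset.Icc 1 n, ∏ j ∈ Finset.Ioc i n,
          (qSinh q (2 * (s i + s j - 1)) * qSinh q (2 * (s j - s i)))) =
    (2 : K) ^ (-(n ^ 2 : ℤ)) *
        q ^ (-∑ i ∈ Finset.Icc 1 n, ((4 * i - 2) * s i - 2 * i ^ 2 - i + 1 : ℤ)) *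
        (((∏ i ∈ Finset.Icc 1 n, qInt (q ^ 2) (2 * s i - 1)) *
          ∏ i ∈ Finset.Icc 1 n, ∏ j ∈ Finset.Ioc i n,
            (qInt (q ^ 2) (2 * (s i + s j - 1)) * qInt (q ^ 2) (2 * (s j - s i)))) /
          ∏ i ∈ Finset.Icc 1 n, qFactorial (q ^ 2) (2 * i - 1)) := by
  have h1 := hs 1 one_ne_zero
  induction n with
  | zero => simp
  | succ n ih =>
    have hsub : Set.Icc 1 n ⊆ Set.Icc 1 (n + 1) := Set.Icc_subset_Icc_right (Nat.le_succ n)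
    have ih := ih (fun i hi => hs1 i (hsub hi)) (hmono.mono hsub)
    have hn1 : n + 1 ∈ Set.Icc 1 (n + 1) := ⟨by omega, le_rfl⟩
    have ha := hs1 _ hn1
    set a := s (n + 1) with ha'
    have hprod : ∏ i ∈ Finset.Icc 1 n,
        (qInt (q ^ 2) (2 * (s i + a - 1)) * qInt (q ^ 2) (2 * (a - s i))) =
        q ^ ((4 * (a : ℤ) - 4) * n) * (∏ i ∈ Finset.Icc 1 n,
          (qSinh q (2 * (s i + a - 1)) * qSinh q (2 * (a - s i)))) / qSinh q 1 ^ (2 * n) := by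
      have : ∀ i ∈ Finset.Icc 1 n,
          qInt (q ^ 2) (2 * (s i + a - 1)) * qInt (q ^ 2) (2 * (a - s i)) =
          q ^ (4 * (a : ℤ) - 4) *
            (qSinh q (2 * (s i + a - 1)) * qSinh q (2 * (a - s i))) / qSinh q 1 ^ 2 := by
        intro i hi
        have hi' : i ∈ Set.Icc 1 (n + 1) := hsub (by simpa using hi)
        exact qInt_mul_qInt_sq hq h1 (hs1 i hi') (hmono hi' hn1 hi'.2)
      rw [Finset.prod_congr rfl this, Finset.prod_div_distrib, Finset.prod_mul_distrib,
        Finset.prod_const, Finset.prod_const, Nat.card_Icc, Nat.add_sub_cancel, ← pow_mul,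
        zpow_mul, zpow_natCast]
    rw [Finset.prod_range_succ, Finset.prod_Icc_succ_top (by omega), prod_Icc_Ioc_succ,
      Finset.prod_Icc_succ_top (by omega), prod_Icc_Ioc_succ, Finset.prod_Icc_succ_top (by omega),
      Finset.sum_Icc_succ_top (by omega), ← ha', hprod, stepFactor_eq,
      show 2 * (n + 1) - 1 = 2 * n + 1 by omega, qFactorial_sq hq h1, qInt_sq hq h1,
      show ((2 * a - 1 : ℕ) : ℤ) = 2 * a - 1 by omega]
    set P := ∏ k ∈ Finset.Icc 1 (2 * n + 1), qSinh q (k : ℕ) with hP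
    have hP0 : P ≠ 0 := Finset.prod_ne_zero_iff.2 fun k hk => hs _ (by
      have := (Finset.mem_Icc.1 hk).1
      omega)
    have e2 : (2 : K) ^ (-((n + 1 : ℕ) ^ 2 : ℤ)) =
        (2 : K) ^ (-(n ^ 2 : ℤ)) * ((2 : K) ^ (2 * n + 1))⁻¹ := by
      rw [← zpow_natCast, ← zpow_neg, ← zpow_add₀ h2]
      congr 1
      push_cast
      ring
    -- The new exponent is `(2a - 2) + (4a - 4) n - n (2n + 1)`: the contributions of `[2a - 1]`, of
    -- the `n` new pairs, and of the factorial `[2n + 1]!`.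
    have e3 : ∀ E : ℤ, q ^ (-(E + ((4 * (n + 1 : ℕ) - 2) * a - 2 * (n + 1 : ℕ) ^ 2 -
        (n + 1 : ℕ) + 1 : ℤ))) = q ^ (-E) * (q ^ ((n : ℤ) * (2 * n + 1)) /
          (q ^ (2 * (a : ℤ) - 1 - 1) * q ^ ((4 * (a : ℤ) - 4) * n))) := by
      intro E
      rw [← zpow_add₀ hq, ← zpow_sub₀ hq, ← zpow_add₀ hq]
      congr 1
      push_cast
      ring
    rw [e2, e3]
    have z1 := zpow_ne_zero ((n : ℤ) * (2 * n + 1)) hq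
    have z2 := zpow_ne_zero (2 * (a : ℤ) - 1 - 1) hq
    have z3 := zpow_ne_zero ((4 * (a : ℤ) - 4) * n) hq
    generalize q ^ ((n : ℤ) * (2 * n + 1)) = Z1 at *
    generalize q ^ (2 * (a : ℤ) - 1 - 1) = Z2 at *
    generalize q ^ ((4 * (a : ℤ) - 4) * n) = Z3 at *
    have z4 := pow_ne_zero (2 * n + 1) h2
    generalize (2 : K) ^ (2 * n + 1) = Z4 at *
    rw [pow_succ (qSinh q 1)]
    have z5 := pow_ne_zero (2 * n) h1
    generalize qSinh q 1 ^ (2 * n) = Z5 at *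
    set X1 := ∏ i ∈ Finset.Icc 1 n,
          (qSinh q (2 * (s i + a - 1)) * qSinh q (2 * (a - s i)))
    rw [mul_inv]
    calc _ = ((∏ k ∈ Finset.range n, stepFactor q k) *
      ((∏ i ∈ Finset.Icc 1 n, qSinh q (2 * s i - 1)) *
        ∏ i ∈ Finset.Icc 1 n, ∏ j ∈ Finset.Ioc i n,
          (qSinh q (2 * (s i + s j - 1)) * qSinh q (2 * (s j - s i))))) *
        (Z4⁻¹ * P⁻¹ * qSinh q (2 * a - 1) * X1) := by ring
      _ = _ := by
        rw [ih]
        field_simp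

/-- The two forms of the product formula agree. -/
theorem prod_qInt_eq (n : ℕ) (s : ℕ → ℕ) (hs1 : ∀ i ∈ Set.Icc 1 n, 1 ≤ s i)
    (hs0 : ∀ k : ℕ, q ^ (4 * k + 2) + 1 ≠ 0) :
    ((∏ i ∈ Finset.Icc 1 n, qInt (q ^ 2) (2 * s i - 1)) *
          ∏ i ∈ Finset.Icc 1 n, ∏ j ∈ Finset.Ioc i n,
            (qInt (q ^ 2) (2 * (s i + s j - 1)) * qInt (q ^ 2) (2 * (s j - s i)))) /
          ∏ i ∈ Finset.Icc 1 n, qFactorial (q ^ 2) (2 * i - 1) =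
    (∏ i ∈ Finset.Icc 1 n, 1 / (q ^ (4 * s i - 2) + 1)) *
        (∏ i ∈ Finset.Icc 1 n, ∏ j ∈ Finset.Icc i n,
          qInt (q ^ 2) (2 * (s i + s j - 1)) / qInt (q ^ 2) (i + j - 1)) *
        ∏ i ∈ Finset.Icc 1 n, ∏ j ∈ Finset.Ioc i n,
          qInt (q ^ 2) (2 * (s j - s i)) / qInt (q ^ 2) (j - i) := by
  induction n with
  | zero => simp
  | succ n ih =>
    have hsub : Set.Icc 1 n ⊆ Set.Icc 1 (n + 1) := Set.Icc_subset_Icc_right (Nat.le_succ n)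
    have ih := ih (fun i hi => hs1 i (hsub hi))
    obtain ⟨b, hb⟩ : ∃ b, s (n + 1) = b + 1 :=
      ⟨s (n + 1) - 1, by have := hs1 (n + 1) ⟨by omega, le_rfl⟩; omega⟩
    -- Duplication `[2m]_p = [m]_p (1 + p ^ m)` with `p = q ^ 2`, `m = 2 * s (n + 1) - 1`. It turns
    -- the diagonal factor of the second form into the single factor of the first.
    have hdup : qInt (q ^ 2) (2 * (s (n + 1) + s (n + 1) - 1)) =
        qInt (q ^ 2) (2 * s (n + 1) - 1) * (q ^ (4 * s (n + 1) - 2) + 1) := by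
      rw [hb, show 2 * (b + 1 + (b + 1) - 1) = (2 * b + 1) + (2 * b + 1) by omega,
        show 2 * (b + 1) - 1 = 2 * b + 1 by omega, show 4 * (b + 1) - 2 = 2 * (2 * b + 1) by omega,
        qInt, Finset.sum_range_add, qInt, pow_mul, mul_add, mul_one, add_comm, Finset.sum_mul]
      congr 1
      exact Finset.sum_congr rfl fun i _ => by rw [pow_add, mul_comm]
    have h0 : q ^ (4 * s (n + 1) - 2) + 1 ≠ 0 := by
      rw [hb, show 4 * (b + 1) - 2 = 4 * b + 2 by omega]
      exact hs0 b
    rw [Finset.prod_Icc_succ_top (by omega), prod_Icc_Ioc_succ, Finset.prod_Icc_succ_top (by omega),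
      Finset.prod_Icc_succ_top (by omega), prod_Icc_Icc_succ, prod_Icc_Ioc_succ, hdup,
      show 2 * (n + 1) - 1 = 2 * n + 1 by omega, qFactorial_two_mul_add_one,
      show n + 1 + (n + 1) - 1 = 2 * n + 1 by omega, Finset.prod_mul_distrib (s := Finset.Icc 1 n),
      Finset.prod_div_distrib (f := fun i => qInt (q ^ 2) (2 * (s i + s (n + 1) - 1))),
      Finset.prod_div_distrib (f := fun i => qInt (q ^ 2) (2 * (s (n + 1) - s i)))]
    have hg := mul_inv_cancel₀ h0
    generalize q ^ (4 * s (n + 1) - 2) + 1 = g at *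
    have alg : ∀ A Q B X Y F D₁ D₂ D₃ P₁ P₂ P₃ : K, A * B / F = P₁ * P₂ * P₃ →
        A * Q * (B * (X * Y)) / (F * (D₁ * D₂ * D₃)) =
          P₁ * (1 / g) * (P₂ * (X / D₁ * (Q * g / D₂))) * (P₃ * (Y / D₃)) := by
      intro A Q B X Y F D₁ D₂ D₃ P₁ P₂ P₃ h
      simp only [div_eq_mul_inv, mul_inv] at h ⊢
      linear_combination Q * X * Y * D₁⁻¹ * D₂⁻¹ * D₃⁻¹ * h -
        P₁ * P₂ * P₃ * Q * X * Y * D₁⁻¹ * D₂⁻¹ * D₃⁻¹ * hg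
    exact alg _ _ _ _ _ _ _ _ _ _ _ _ ih

end qInt

/-! ### The region of the theorem and the field of rational functions -/

/-- The zigzag admits exactly the triangles whose axis has `a ≥ 0`: those with `a = 0` reach to `-1`
only at odd heights, while those with `a = -1` have a vertex at `-2`. -/
theorem trapezoid_eq_upperRegion (x n : ℕ) :
    trapezoid x n = upperRegion (2 * (x + n)) (2 * n) 0 := by
  ext ⟨a, r⟩
  rw [trapezoid, Finset.mem_filter, mem_upperRegion]
  simp only [Finset.mem_product, Finset.mem_Icc, Finset.mem_Ico, UnitTriangle.vertices, westEnd,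
    eastEnd]
  rcases Int.emod_two_eq_zero_or_one r with hr | hr <;>
    rcases Int.emod_two_eq_zero_or_one a with ha | ha
  · have h1 : ¬ UnitTriangle.IsUp (a, r) := by
      simp only [UnitTriangle.IsUp, Int.odd_iff]
      omega
    have h2 : Even r := Int.even_iff.2 hr
    have h3 : ¬ Even (r + 1) := by rw [Int.even_iff]; omega
    simp [h1, h2, h3]
    omega
  · have h1 : UnitTriangle.IsUp (a, r) := by
      simp only [UnitTriangle.IsUp, Int.odd_iff]
      omega
    have h2 : Even r := Int.even_iff.2 hr
    have h3 : ¬ Even (r + 1) := by rw [Int.even_iff]; omega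
    simp [h1, h2, h3]
    omega
  · have h1 : UnitTriangle.IsUp (a, r) := by
      simp only [UnitTriangle.IsUp, Int.odd_iff]
      omega
    have h2 : ¬ Even r := by rw [Int.even_iff]; omega
    have h3 : Even (r + 1) := by rw [Int.even_iff]; omega
    simp [h1, h2, h3]
    omega
  · have h1 : ¬ UnitTriangle.IsUp (a, r) := by
      simp only [UnitTriangle.IsUp, Int.odd_iff]
      omega
    have h2 : ¬ Even r := by rw [Int.even_iff]; omega
    have h3 : Even (r + 1) := by rw [Int.even_iff]; omega
    simp [h1, h2, h3]
    omega

theorem ratFunc_algebraMap_ne_zero {p : Polynomial ℚ} (hp : p ≠ 0) :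
    algebraMap (Polynomial ℚ) (RatFunc ℚ) p ≠ 0 :=
  (map_ne_zero_iff _ (RatFunc.algebraMap_injective ℚ)).2 hp

theorem ratFunc_X_pow_sub_one_ne_zero {m : ℕ} (hm : 0 < m) :
    (RatFunc.X : RatFunc ℚ) ^ m - 1 ≠ 0 := by
  have h := ratFunc_algebraMap_ne_zero (Polynomial.X_pow_sub_C_ne_zero hm (1 : ℚ))
  simpa using h

theorem qSinh_ratFunc_X_ne_zero {k : ℤ} (hk : k ≠ 0) : qSinh (RatFunc.X : RatFunc ℚ) k ≠ 0 := by
  have hpos : ∀ m : ℕ, 0 < m → qSinh (RatFunc.X : RatFunc ℚ) m ≠ 0 := by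
    intro m hm h
    have hX : (RatFunc.X : RatFunc ℚ) ^ m ≠ 0 := pow_ne_zero _ RatFunc.X_ne_zero
    refine ratFunc_X_pow_sub_one_ne_zero (m := m + m) (by omega) ?_
    rw [qSinh, zpow_neg, zpow_natCast] at h
    rw [pow_add]
    nth_rewrite 2 [sub_eq_zero.1 h]
    rw [mul_inv_cancel₀ hX, sub_self]
  rcases Int.eq_nat_or_neg k with ⟨m, rfl | rfl⟩
  · exact hpos m (by omega)
  · rw [qSinh_neg]
    exact neg_ne_zero.2 (hpos m (by omega))

theorem ratFunc_X_pow_add_one_ne_zero {m : ℕ} (hm : 0 < m) :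
    (RatFunc.X : RatFunc ℚ) ^ m + 1 ≠ 0 := by
  intro h
  refine ratFunc_X_pow_sub_one_ne_zero (m := m + m) (by omega) ?_
  rw [pow_add]
  -- `X ^ m + 1` divides `X ^ (2 * m) - 1`.
  linear_combination (RatFunc.X ^ m - 1 : RatFunc ℚ) * h

/-- The generating function of the quartered hexagon as a product over the dents. -/
theorem tilingGF_quarteredHexagon {K : Type*} [Field K] {q : K} (hq : q ≠ 0)
    (hs : ∀ k : ℤ, k ≠ 0 → qSinh q k ≠ 0) (h2 : (2 : K) ≠ 0) (x n : ℕ) (s : ℕ → ℕ)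
    (hs1 : ∀ i ∈ Set.Icc 1 n, 1 ≤ s i ∧ s i ≤ n + x) (hmono : StrictMonoOn s (Set.Icc 1 n)) :
    tilingGF (quarteredHexagon x n s) (wt₂ q) =
      (∏ k ∈ Finset.range n, stepFactor q k) *
      ((∏ i ∈ Finset.Icc 1 n, qSinh q (2 * s i - 1)) *
        ∏ i ∈ Finset.Icc 1 n, ∏ j ∈ Finset.Ioc i n,
          (qSinh q (2 * (s i + s j - 1)) * qSinh q (2 * (s j - s i)))) := by
  have hmem : ∀ i : Fin n, (i : ℕ) + 1 ∈ Set.Icc 1 n := fun i => ⟨by omega, i.2⟩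
  have h := tilingGF_upperRegion_sdiff hq hs h2 x n n le_rfl (fun i => s (i + 1) - 1)
    (fun i j hij => by
      have h1 := hmono (hmem i) (hmem j) (Nat.add_lt_add_right (Fin.lt_def.1 hij) 1)
      have h3 := (hs1 _ (hmem i)).1
      simp only
      omega)
    (fun i => by
      have := hs1 _ (hmem i)
      omega)
  have e : ∀ i : Fin n, 2 * ((s (i + 1) - 1 : ℕ) : ℤ) + 1 = 2 * s (i + 1) - 1 := fun i => by
    have := (hs1 _ (hmem i)).1
    omega
  simp only [e, sub_self, mul_zero] at h
  have himg : (Finset.univ.image fun i : Fin n => (2 * (s (i + 1) : ℤ) - 1, (0 : ℤ))) =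
      (Finset.Icc 1 n).image fun i => baseTriangle (s i) := by
    ext t
    simp only [Finset.mem_image, Finset.mem_univ, true_and, Finset.mem_Icc, baseTriangle]
    constructor
    · rintro ⟨i, rfl⟩
      exact ⟨i + 1, hmem i, rfl⟩
    · rintro ⟨i, hi, rfl⟩
      exact ⟨⟨i - 1, by omega⟩, by simp only [Nat.sub_add_cancel hi.1]⟩
  rw [quarteredHexagon, trapezoid_eq_upperRegion, ← himg]
  refine h.trans ?_
  rw [det_qSinh hq fun i : Fin n => 2 * (s (i + 1) : ℤ) - 1]
  congr 2
  · exact prod_fin_add_one n fun i => qSinh q (2 * s i - 1)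
  · rw [← prod_fin_Ioi_add_one n fun i j =>
      qSinh q (2 * (s i + s j - 1)) * qSinh q (2 * (s j - s i))]
    refine Finset.prod_congr rfl fun i _ => Finset.prod_congr rfl fun j _ => ?_
    congr 2 <;> ring

theorem mainTheorem6 (x n : ℕ) (s : ℕ → ℕ)
    (hs : ∀ i ∈ Set.Icc 1 n, 1 ≤ s i ∧ s i ≤ n + x)
    (hmono : StrictMonoOn s (Set.Icc 1 n))
    (q : RatFunc ℚ) (hq : q = RatFunc.X) :
    tilingGF (quarteredHexagon x n s) (wt₂ q) =
        (2 : RatFunc ℚ) ^ (-(n ^ 2 : ℤ)) *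
        q ^ (-∑ i ∈ Finset.Icc 1 n, ((4 * i - 2) * s i - 2 * i ^ 2 - i + 1 : ℤ)) *
        (((∏ i ∈ Finset.Icc 1 n, qInt (q ^ 2) (2 * s i - 1)) *
          ∏ i ∈ Finset.Icc 1 n, ∏ j ∈ Finset.Ioc i n,
            (qInt (q ^ 2) (2 * (s i + s j - 1)) * qInt (q ^ 2) (2 * (s j - s i)))) /
          ∏ i ∈ Finset.Icc 1 n, qFactorial (q ^ 2) (2 * i - 1)) ∧
    tilingGF (quarteredHexagon x n s) (wt₂ q) =
        (2 : RatFunc ℚ) ^ (-(n ^ 2 : ℤ)) *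
        q ^ (-∑ i ∈ Finset.Icc 1 n, ((4 * i - 2) * s i - 2 * i ^ 2 - i + 1 : ℤ)) *
        (∏ i ∈ Finset.Icc 1 n, 1 / (q ^ (4 * s i - 2) + 1)) *
        (∏ i ∈ Finset.Icc 1 n, ∏ j ∈ Finset.Icc i n,
          qInt (q ^ 2) (2 * (s i + s j - 1)) / qInt (q ^ 2) (i + j - 1)) *
        ∏ i ∈ Finset.Icc 1 n, ∏ j ∈ Finset.Ioc i n,
          qInt (q ^ 2) (2 * (s j - s i)) / qInt (q ^ 2) (j - i) := by
  subst hq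
  have h2 : (2 : RatFunc ℚ) ≠ 0 := two_ne_zero
  have h := (tilingGF_quarteredHexagon RatFunc.X_ne_zero (fun _ => qSinh_ratFunc_X_ne_zero) h2
    x n s hs hmono).trans (prod_qSinh_eq_qInt RatFunc.X_ne_zero
      (fun _ => qSinh_ratFunc_X_ne_zero) h2 n s (fun i hi => (hs i hi).1) hmono.monotoneOn)
  refine ⟨h, ?_⟩
  rw [h, prod_qInt_eq n s (fun i hi => (hs i hi).1)
    fun k => ratFunc_X_pow_add_one_ne_zero (by omega)]
  simp only [mul_assoc]
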